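/- Let $(A,\Sigma,\mu)$ and $(B,\Xi,\nu)$ be $\sigma$-finite measure spaces. Let $\Sigma'=\Sigma/\Sigma_0$ and $\Xi'=\Xi/\Xi_0$ be the Boolean algebras of measurable sets modulo null sets. Let $L_0(\mu)$, $L_0(\nu)$ be the vector lattices of a.e.-equivalence classes of real measurable functions. For finite measures $\lambda_A$ and $\lambda_B$ with the same null sets as $\mu$ and $\nu$ respectively, give $L_0(\mu)$ the metric $\varrho(f,g)=\int_A\frac{|f-g|}{1+|f-g|}\,d\lambda_A$ and $L_0(\nu)$ the corresponding metric formed with $\lambda_B$. Let $\Phi:\Sigma'\to\Xi'$ be a Boolean isomorphism. Let $S_\Phi:L_0(\mu)\to L_0(\nu)$ be its shift operator, defined as follows. For a simple function $f=\sum_i r_i1_{A_i}\ge 0$ with the $A_i$ mutually disjoint, $S_\Phi f=\sum_i r_i1_{\Phi(A_i)}$. For $f\ge0$, $S_\Phi f=\sup_n S_\Phi f_n$ for any increasing sequence of simple functions $f_n\ge0$ with $\sup_n f_n=f$. For general $f$, $S_\Phi f=S_\Phi f_+-S_\Phi f_-$. Call an operator $T:L_0(\mu)\to L_0(\nu)$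 orthogonally additive if $T(f+g)=Tf+Tg$ whenever $|f|\wedge|g|=0$, and regular orthogonally additive if $T=T_1-T_2$ with $T_1,T_2$ orthogonally additive and $T_if\ge0$ for all $f\in L_0(\mu)$. Every order projection on $L_0$ (a linear projection $\pi$ with $0\le\pi\le \mathrm{Id}$) is the multiplication $\pi_D$ by $1_D$ for a unique class $D$ of measurable sets modulo null sets. Call $T$ atomic subordinate to $\Phi$ if $T\pi_D=\pi_{\Phi(D)}T$ for every $D\in\Sigma'$. Let $T:L_0(\mu)\to L_0(\nu)$ be a regular orthogonally additive operator. Then the following are equivalent: 1. $T$ is continuous with respect to the metrics above and atomic subordinate to $\Phi$. 2. There is a function $N:B\times\mathbb R\to\mathbb R$ such that $N(\cdot,r)$ is measurable for every $r\in\mathbb R$, $N(s,\cdot)$ is continuous for $\nu$-almost every $s\in B$, $N(s,0)=0$ for $\nu$-almost every $s\in B$, and $T=T_N\circ S_\Phi$, where $T_Ng=N(\cdot,g(\cdot))$; that is, $Tf=N(\cdot,(S_\Phi f)(\cdot))$ for every $f\in L_0(\mu)$. -/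

import Mathlib

open MeasureTheory

noncomputable section

namespace AtomicOperators

/-! ### Vector lattices: orthogonally additive maps, order projections, atomic maps -/

section VectorLattice

variable {E F : Type*} [Lattice E] [AddCommGroup E] [Module ℝ E]
  [Lattice F] [AddCommGroup F] [Module ℝ F]

/-- Two elements of a vector lattice are disjoint if `|x| ∧ |y| = 0`. -/
def LatticeDisjoint (x y : E) : Prop := |x| ⊓ |y| = 0

/-- `T (x + y) = T x + T y` for all disjoint `x`, `y`. -/
def IsOrthogonallyAdditive (T : E → F) : Prop :=
  ∀ x y : E, LatticeDisjoint x y → T (x + y) = T x + T y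

/-- A map between vector lattices is positive if all its values are positive. (An orthogonally
additive map is not required to be linear.) -/
def IsPositiveMap (T : E → F) : Prop := ∀ x : E, 0 ≤ T x

/-- A regular orthogonally additive operator: a difference of two positive orthogonally additive
operators. -/
def IsRegularOA (T : E → F) : Prop :=
  ∃ T₁ T₂ : E → F,
    (IsOrthogonallyAdditive T₁ ∧ IsPositiveMap T₁) ∧
    (IsOrthogonallyAdditive T₂ ∧ IsPositiveMap T₂) ∧
    T = fun x => T₁ x - T₂ x

/-- Order projections: linear maps `π` with `π ∘ π = π` and `0 ≤ π ≤ Id`. -/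
structure IsOrderProjection (π : E →ₗ[ℝ] E) : Prop where
  idem : ∀ x, π (π x) = π x
  nonneg : ∀ x, 0 ≤ x → 0 ≤ π x
  le_id : ∀ x, 0 ≤ x → π x ≤ x

variable (E) in
/-- The set `𝔅(E)` of all order projections on `E`. -/
def OrderProjection : Type _ := {π : E →ₗ[ℝ] E // IsOrderProjection π}

/-- `T` is atomic subordinate to `Φ : 𝔅(E) → 𝔅(F)` if `T π = Φ(π) T` for every `π ∈ 𝔅(E)`. -/
def IsAtomicSubordinate (Φ : OrderProjection E → OrderProjection F) (T : E → F) : Prop :=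
  ∀ (π : OrderProjection E) (x : E), T (π.1 x) = (Φ π).1 (T x)

end VectorLattice

/-- Boolean homomorphisms between Boolean algebras. -/
structure IsBooleanHom {P Q : Type*} [BooleanAlgebra P] [BooleanAlgebra Q] (Φ : P → Q) :
    Prop where
  map_sup : ∀ x y, Φ (x ⊔ y) = Φ x ⊔ Φ y
  map_inf : ∀ x y, Φ (x ⊓ y) = Φ x ⊓ Φ y
  map_compl : ∀ x, Φ xᶜ = (Φ x)ᶜ

/-! ### The measure algebra `Σ' = Σ / Σ₀` -/

section MeasureAlgebra

variable {A : Type*} [MeasurableSpace A]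

/-- Measurable sets are identified when they differ by a null set. -/
def nullSetoid (μ : Measure A) : Setoid {s : Set A // MeasurableSet s} where
  r s t := s.1 =ᵐ[μ] t.1
  iseqv := ⟨fun _ => ae_eq_refl _, fun h => h.symm, fun h k => h.trans k⟩

/-- The factor algebra of the measurable sets modulo the null sets. -/
def MeasAlg (μ : Measure A) : Type _ := Quotient (nullSetoid μ)

/-- The class of a measurable set in the measure algebra. -/
def MeasAlg.mk (μ : Measure A) (s : Set A) (hs : MeasurableSet s) : MeasAlg μ :=
  Quotient.mk (nullSetoid μ) ⟨s, hs⟩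

instance (μ : Measure A) : BooleanAlgebra (MeasAlg μ) where
  le := Quotient.lift₂ (fun s t => s.1 ≤ᵐ[μ] t.1) (by
    intro s t s' t' (h : s.1 =ᵐ[μ] s'.1) (k : t.1 =ᵐ[μ] t'.1)
    exact propext ⟨fun l => h.symm.le.trans (l.trans k.le),
      fun l => h.le.trans (l.trans k.symm.le)⟩)
  sup := Quotient.map₂ (fun s t => ⟨s.1 ∪ t.1, s.2.union t.2⟩)
    (fun _ _ h _ _ k => Filter.EventuallyEq.union h k)
  inf := Quotient.map₂ (fun s t => ⟨s.1 ∩ t.1, s.2.inter t.2⟩)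
    (fun _ _ h _ _ k => Filter.EventuallyEq.inter h k)
  compl := Quotient.map (fun s => ⟨s.1ᶜ, s.2.compl⟩)
    (fun _ _ h => Filter.EventuallyEq.compl h)
  top := MeasAlg.mk μ Set.univ MeasurableSet.univ
  bot := MeasAlg.mk μ ∅ MeasurableSet.empty
  le_refl := by
    rintro ⟨s⟩
    exact Filter.EventuallyLE.refl _ s.1
  le_trans := by
    rintro ⟨s⟩ ⟨t⟩ ⟨u⟩ h k
    exact Filter.EventuallyLE.trans h k
  le_antisymm := by
    rintro ⟨s⟩ ⟨t⟩ h k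
    exact Quotient.sound (Filter.EventuallyLE.antisymm h k)
  le_sup_left := by
    rintro ⟨s⟩ ⟨t⟩
    exact Filter.Eventually.of_forall (fun x hx => Or.inl hx)
  le_sup_right := by
    rintro ⟨s⟩ ⟨t⟩
    exact Filter.Eventually.of_forall (fun x hx => Or.inr hx)
  sup_le := by
    rintro ⟨s⟩ ⟨t⟩ ⟨u⟩ h k
    filter_upwards [h, k] with x h k hx
    exact hx.elim h k
  inf_le_left := by
    rintro ⟨s⟩ ⟨t⟩
    exact Filter.Eventually.of_forall (fun x hx => hx.1)
  inf_le_right := by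
    rintro ⟨s⟩ ⟨t⟩
    exact Filter.Eventually.of_forall (fun x hx => hx.2)
  le_inf := by
    rintro ⟨s⟩ ⟨t⟩ ⟨u⟩ h k
    filter_upwards [h, k] with x h k hx
    exact ⟨h hx, k hx⟩
  le_sup_inf := by
    rintro ⟨s⟩ ⟨t⟩ ⟨u⟩
    refine Filter.Eventually.of_forall (fun x hx => ?_)
    rcases hx with ⟨h | h, k | k⟩
    · exact Or.inl h
    · exact Or.inl h
    · exact Or.inl k
    · exact Or.inr ⟨h, k⟩
  inf_compl_le_bot := by
    rintro ⟨s⟩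
    exact Filter.Eventually.of_forall (fun x hx => (hx.2 hx.1).elim)
  top_le_sup_compl := by
    rintro ⟨s⟩
    exact Filter.Eventually.of_forall (fun x _ => Classical.em (x ∈ s.1))
  le_top := by
    rintro ⟨s⟩
    exact Filter.Eventually.of_forall (fun x _ => Set.mem_univ x)
  bot_le := by
    rintro ⟨s⟩
    exact Filter.Eventually.of_forall (fun x hx => False.elim hx)

end MeasureAlgebra

/-! ### The vector lattice `L₀(μ)` and its order projections -/

section LZero

variable {A : Type*} [MeasurableSpace A]

/-- `L₀(μ)`: classes modulo a.e. equality of real measurable functions, with the a.e. order. -/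
abbrev LZero (μ : Measure A) : Type _ := A →ₘ[μ] ℝ

/-- `∫ |f - g| / (1 + |f - g|) dlam`. When `lam` is a finite measure with the same null sets as
`μ`, this is the metric on `L₀(μ)`. -/
def rhoLZero {μ : Measure A} (lam : Measure A) (f g : LZero μ) : ℝ :=
  ∫ s, |f s - g s| / (1 + |f s - g s|) ∂lam

/-- The characteristic function `1_D` of an element `D` of the measure algebra. -/
def chi {μ : Measure A} (D : MeasAlg μ) : LZero μ :=
  Quotient.liftOn D
    (fun s => AEEqFun.mk (s.1.indicator (fun _ => (1 : ℝ)))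
      (aestronglyMeasurable_const.indicator s.2))
    (fun _ _ h => AEEqFun.mk_eq_mk.2 (indicator_ae_eq_of_ae_eq_set h))

lemma coeFn_chi_mk {μ : Measure A} (s : Set A) (hs : MeasurableSet s) :
    (chi (MeasAlg.mk μ s hs) : A → ℝ) =ᵐ[μ] s.indicator (fun _ => (1 : ℝ)) :=
  AEEqFun.coeFn_mk _ _

/-- Multiplication by the characteristic function `1_D`. -/
def mulChi {μ : Measure A} (D : MeasAlg μ) : LZero μ →ₗ[ℝ] LZero μ where
  toFun f := chi D * f
  map_add' f g := by
    refine AEEqFun.ext ?_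
    filter_upwards [AEEqFun.coeFn_mul (chi D) (f + g), AEEqFun.coeFn_mul (chi D) f,
      AEEqFun.coeFn_mul (chi D) g, AEEqFun.coeFn_add f g,
      AEEqFun.coeFn_add (chi D * f) (chi D * g)] with s h1 h2 h3 h4 h5
    simp only [Pi.mul_apply, Pi.add_apply] at *
    rw [h1, h5, h2, h3, h4]
    ring
  map_smul' c f := by
    refine AEEqFun.ext ?_
    filter_upwards [AEEqFun.coeFn_mul (chi D) (c • f), AEEqFun.coeFn_mul (chi D) f,
      AEEqFun.coeFn_smul c f, AEEqFun.coeFn_smul c (chi D * f)] with s h1 h2 h3 h4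
    simp only [Pi.mul_apply, Pi.smul_apply, smul_eq_mul, RingHom.id_apply] at *
    rw [h1, h4, h2, h3]
    ring

lemma coeFn_mulChi_mk {μ : Measure A} (s : Set A) (hs : MeasurableSet s) (f : LZero μ) :
    (mulChi (MeasAlg.mk μ s hs) f : A → ℝ) =ᵐ[μ] s.indicator f := by
  filter_upwards [AEEqFun.coeFn_mul (chi (MeasAlg.mk μ s hs)) f, coeFn_chi_mk (μ := μ) s hs]
    with x h1 h2
  have h3 : (mulChi (MeasAlg.mk μ s hs) f) x = (chi (MeasAlg.mk μ s hs) * f : LZero μ) x := rfl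
  rw [h3, h1, Pi.mul_apply, h2]
  by_cases hx : x ∈ s <;> simp [hx]

lemma LZero.nonneg_iff {μ : Measure A} {f : LZero μ} : 0 ≤ f ↔ ∀ᵐ s ∂μ, 0 ≤ f s := by
  rw [← AEEqFun.coeFn_le]
  constructor
  · intro h
    filter_upwards [h, AEEqFun.coeFn_zero (μ := μ) (β := ℝ)] with s h1 h2
    rw [h2] at h1
    exact h1
  · intro h
    filter_upwards [h, AEEqFun.coeFn_zero (μ := μ) (β := ℝ)] with s h1 h2
    rw [h2]
    exact h1

lemma LZero.sub_nonneg {μ : Measure A} {f g : LZero μ} : 0 ≤ g - f ↔ f ≤ g := by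
  rw [LZero.nonneg_iff, ← AEEqFun.coeFn_le]
  constructor
  · intro h
    filter_upwards [h, AEEqFun.coeFn_sub g f] with s h1 h2
    rw [h2, Pi.sub_apply] at h1
    linarith
  · intro h
    filter_upwards [h, AEEqFun.coeFn_sub g f] with s h1 h2
    rw [h2, Pi.sub_apply]
    linarith

lemma isOrderProjection_mulChi {μ : Measure A} (D : MeasAlg μ) :
    IsOrderProjection (mulChi D) := by
  obtain ⟨⟨s, hs⟩, rfl⟩ := Quotient.exists_rep D
  change IsOrderProjection (mulChi (MeasAlg.mk μ s hs))
  refine ⟨fun f => AEEqFun.ext ?_, fun f hf => ?_, fun f hf => ?_⟩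
  · filter_upwards [coeFn_mulChi_mk s hs f,
      coeFn_mulChi_mk s hs (mulChi (MeasAlg.mk μ s hs) f)] with x h1 h2
    rw [h2]
    by_cases hx : x ∈ s
    · simp [hx]
    · rw [h1]
      simp [hx]
  · rw [LZero.nonneg_iff] at hf ⊢
    filter_upwards [coeFn_mulChi_mk s hs f, hf] with x h1 h2
    rw [h1]
    exact Set.indicator_apply_nonneg fun _ => h2
  · rw [← AEEqFun.coeFn_le]
    rw [LZero.nonneg_iff] at hf
    filter_upwards [coeFn_mulChi_mk s hs f, hf] with x h1 h2
    rw [h1]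
    exact Set.indicator_apply_le' (fun _ => le_rfl) (fun _ => h2)

/-- The order projection `π_D` on `L₀(μ)`. -/
def projOfMeasAlg {μ : Measure A} (D : MeasAlg μ) : OrderProjection (LZero μ) :=
  ⟨mulChi D, isOrderProjection_mulChi D⟩

lemma projOfMeasAlg_injective {μ : Measure A} :
    Function.Injective (projOfMeasAlg (μ := μ)) := by
  intro D D' h
  obtain ⟨⟨s, hs⟩, rfl⟩ := Quotient.exists_rep D
  obtain ⟨⟨t, ht⟩, rfl⟩ := Quotient.exists_rep D'
  have h1 : mulChi (MeasAlg.mk μ s hs) 1 = mulChi (MeasAlg.mk μ t ht) 1 :=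
    congrArg (fun p : OrderProjection (LZero μ) => p.1 1) h
  refine Quotient.sound ?_
  change s =ᵐ[μ] t
  filter_upwards [coeFn_mulChi_mk s hs (1 : LZero μ), coeFn_mulChi_mk t ht (1 : LZero μ),
    AEEqFun.coeFn_one (μ := μ) (β := ℝ)] with x e1 e2 e3
  rw [h1, e2] at e1
  apply propext
  change x ∈ s ↔ x ∈ t
  by_cases hx : x ∈ s <;> by_cases hy : x ∈ t <;> simp_all

lemma IsOrderProjection.mono {μ : Measure A} {π : LZero μ →ₗ[ℝ] LZero μ}
    (hπ : IsOrderProjection π) {f g : LZero μ} (h : f ≤ g) : π f ≤ π g := by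
  rw [← LZero.sub_nonneg, ← map_sub]
  exact hπ.nonneg _ (LZero.sub_nonneg.2 h)

lemma IsOrderProjection.fixed {μ : Measure A} {π : LZero μ →ₗ[ℝ] LZero μ}
    (hπ : IsOrderProjection π) {h f : LZero μ} (h0 : 0 ≤ h) (hf : h ≤ π f) : π h = h := by
  have h1 : π (π f - h) ≤ π f - h := hπ.le_id _ (LZero.sub_nonneg.2 hf)
  rw [map_sub, hπ.idem] at h1
  refine le_antisymm (hπ.le_id _ h0) ?_
  rw [← LZero.sub_nonneg] at h1 ⊢
  have e : π h - h = π f - h - (π f - π h) := by abel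
  rwa [e]

lemma IsOrderProjection.killed {μ : Measure A} {π : LZero μ →ₗ[ℝ] LZero μ}
    (hπ : IsOrderProjection π) {h f : LZero μ} (h0 : 0 ≤ h) (hf : h ≤ f - π f) : π h = 0 := by
  have h1 := hπ.mono hf
  rw [map_sub, hπ.idem, sub_self] at h1
  exact le_antisymm h1 (hπ.nonneg _ h0)

/-- Every order projection on `L₀(μ)` is the multiplication by a characteristic function. -/
lemma projOfMeasAlg_surjective {μ : Measure A} :
    Function.Surjective (projOfMeasAlg (μ := μ)) := by
  rintro ⟨π, hπ⟩
  have one_nonneg' : (0 : LZero μ) ≤ 1 := by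
    rw [LZero.nonneg_iff]
    filter_upwards [AEEqFun.coeFn_one (μ := μ) (β := ℝ)] with s h
    rw [h]
    exact zero_le_one
  let e : LZero μ := π 1
  have key : ∀ f : LZero μ, 0 ≤ f → ∀ᵐ s ∂μ,
      0 ≤ π f s ∧ π f s ≤ f s ∧ min 1 (π f s) ≤ e s ∧ min 1 (f s - π f s) ≤ 1 - e s := by
    intro f hf
    have hu : 0 ≤ π f := hπ.nonneg f hf
    have hv : 0 ≤ f - π f := LZero.sub_nonneg.2 (hπ.le_id f hf)
    have a1 : π (1 ⊓ π f) = 1 ⊓ π f := hπ.fixed (le_inf one_nonneg' hu) inf_le_right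
    have a2 : (1 ⊓ π f) ≤ e := by
      rw [← a1]
      exact hπ.mono inf_le_left
    have b1 : π (1 ⊓ (f - π f)) = 0 := hπ.killed (le_inf one_nonneg' hv) inf_le_right
    have b2 : (1 ⊓ (f - π f)) ≤ 1 - e := by
      have c := hπ.le_id (1 - 1 ⊓ (f - π f)) (LZero.sub_nonneg.2 inf_le_left)
      rw [map_sub, b1, sub_zero] at c
      rw [← LZero.sub_nonneg] at c ⊢
      have e' : 1 - e - 1 ⊓ (f - π f) = 1 - 1 ⊓ (f - π f) - π 1 := by
        change 1 - π 1 - 1 ⊓ (f - π f) = 1 - 1 ⊓ (f - π f) - π 1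
        abel
      rwa [e']
    rw [← AEEqFun.coeFn_le] at a2 b2
    filter_upwards [a2, b2, LZero.nonneg_iff.1 hu, AEEqFun.coeFn_le.2 (hπ.le_id f hf),
      AEEqFun.coeFn_inf 1 (π f), AEEqFun.coeFn_inf 1 (f - π f), AEEqFun.coeFn_sub f (π f),
      AEEqFun.coeFn_sub 1 e, AEEqFun.coeFn_one (μ := μ) (β := ℝ)] with s h1 h2 h3 h4 h5 h6 h7 h8 h9
    rw [h5, h9] at h1
    rw [h6, h8, h9, h7] at h2
    simp only [Pi.sub_apply, h9, Pi.one_apply] at h1 h2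
    exact ⟨h3, h4, h1, h2⟩
  have e01 : ∀ᵐ s ∂μ, e s = 0 ∨ e s = 1 := by
    have he0 : 0 ≤ e := hπ.nonneg 1 one_nonneg'
    have he1 : 0 ≤ 1 - e := LZero.sub_nonneg.2 (hπ.le_id 1 one_nonneg')
    have w0 : e ⊓ (1 - e) = 0 := by
      rw [← hπ.fixed (le_inf he0 he1) inf_le_left]
      exact hπ.killed (le_inf he0 he1) inf_le_right
    filter_upwards [AEEqFun.coeFn_inf e (1 - e), AEEqFun.coeFn_sub 1 e,
      AEEqFun.coeFn_one (μ := μ) (β := ℝ), AEEqFun.coeFn_zero (μ := μ) (β := ℝ)]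
      with s h1 h2 h3 h4
    rw [w0, h2, Pi.sub_apply, h3, h4, Pi.one_apply, Pi.zero_apply] at h1
    rcases min_choice (e s) (1 - e s) with h | h
    · exact Or.inl (h.symm.trans h1.symm)
    · have h5 : 1 - e s = 0 := h.symm.trans h1.symm
      exact Or.inr (by linarith)
  have hs : MeasurableSet {s | e s ≠ 0} :=
    (measurableSet_singleton (0 : ℝ)).compl.preimage e.measurable
  have pos : ∀ f : LZero μ, 0 ≤ f → mulChi (MeasAlg.mk μ _ hs) f = π f := by
    intro f hf
    refine AEEqFun.ext ?_
    filter_upwards [key f hf, e01, coeFn_mulChi_mk _ hs f] with s hk he hm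
    rw [hm]
    obtain ⟨k1, k2, k3, k4⟩ := hk
    rcases he with hx | hx
    · have h0 : π f s = 0 := by
        rw [hx] at k3
        rcases min_le_iff.1 k3 with h | h <;> linarith
      simp [hx, h0]
    · have h0 : f s = π f s := by
        rw [hx] at k4
        rcases min_le_iff.1 k4 with h | h <;> linarith
      simp [hx, ← h0]
  refine ⟨MeasAlg.mk μ _ hs, Subtype.ext (LinearMap.ext fun f => ?_)⟩
  have hdec : f = f ⊔ 0 - (-f) ⊔ 0 := by
    refine AEEqFun.ext ?_
    filter_upwards [AEEqFun.coeFn_sub (f ⊔ 0) ((-f) ⊔ 0), AEEqFun.coeFn_sup f 0,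
      AEEqFun.coeFn_sup (-f) 0, AEEqFun.coeFn_neg f,
      AEEqFun.coeFn_zero (μ := μ) (β := ℝ)] with s h1 h2 h3 h4 h5
    rw [h1, Pi.sub_apply, h2, h3, h4, h5, Pi.neg_apply, Pi.zero_apply]
    rcases le_total (f s) 0 with h | h
    · rw [max_eq_right h, max_eq_left (by linarith)]
      ring
    · rw [max_eq_left h, max_eq_right (by linarith)]
      ring
  change mulChi (MeasAlg.mk μ _ hs) f = π f
  rw [hdec, map_sub, map_sub, pos _ le_sup_right, pos _ le_sup_right]

/-- The identification `D ↦ π_D` of the measure algebra with the order projections on `L₀(μ)`. -/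
def measAlgEquivOrderProjection (μ : Measure A) : MeasAlg μ ≃ OrderProjection (LZero μ) :=
  Equiv.ofBijective projOfMeasAlg ⟨projOfMeasAlg_injective, projOfMeasAlg_surjective⟩

end LZero

/-! ### Shift operators and superposition operators -/

section Operators

variable {A B : Type*} [MeasurableSpace A] [MeasurableSpace B]

/-- A map `Φ : Σ' → Ξ'` regarded as a map `𝔅(L₀(μ)) → 𝔅(L₀(ν))`. -/
def orderProjectionMap {μ : Measure A} {ν : Measure B} (Φ : MeasAlg μ → MeasAlg ν) :
    OrderProjection (LZero μ) → OrderProjection (LZero ν) :=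
  fun π => measAlgEquivOrderProjection ν (Φ ((measAlgEquivOrderProjection μ).symm π))

/-- Continuity of `T : L₀(μ) → L₀(ν)` with respect to the metrics of `L₀(μ)` and `L₀(ν)` formed
with `lamA` and `lamB`. -/
def IsRhoContinuous {μ : Measure A} {ν : Measure B} (lamA : Measure A) (lamB : Measure B)
    (T : LZero μ → LZero ν) : Prop :=
  ∀ f : LZero μ, ∀ ε : ℝ, 0 < ε → ∃ δ : ℝ, 0 < δ ∧
    ∀ g : LZero μ, rhoLZero lamA g f < δ → rhoLZero lamB (T g) (T f) < ε

/-- The class in `L₀(μ)` of a real simple function. -/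
def simpleClass (μ : Measure A) (φ : SimpleFunc A ℝ) : LZero μ :=
  AEEqFun.mk φ φ.aestronglyMeasurable

/-- `S_Φ` on simple functions: `∑ rᵢ 1_{Aᵢ} ↦ ∑ rᵢ 1_{Φ(Aᵢ)}`, where the `rᵢ` are the values of
the simple function and the `Aᵢ` its level sets. -/
def shiftSimple {μ : Measure A} {ν : Measure B} (Φ : MeasAlg μ → MeasAlg ν)
    (φ : SimpleFunc A ℝ) : LZero ν :=
  ∑ r ∈ φ.range, r • chi (Φ (MeasAlg.mk μ (φ ⁻¹' {r}) (φ.measurableSet_fiber r)))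

/-- `g = sup S_Φ fₙ` for some increasing sequence of positive simple functions `fₙ` with
`f = sup fₙ`, the suprema being taken in `L₀(ν)` and `L₀(μ)`. -/
def IsShiftOfNonneg {μ : Measure A} {ν : Measure B} (Φ : MeasAlg μ → MeasAlg ν)
    (f : LZero μ) (g : LZero ν) : Prop :=
  ∃ φ : ℕ → SimpleFunc A ℝ, (∀ n, 0 ≤ φ n) ∧ Monotone φ ∧
    IsLUB (Set.range fun n => simpleClass μ (φ n)) f ∧
    IsLUB (Set.range fun n => shiftSimple Φ (φ n)) g

open Classical in
/-- `S_Φ` on positive elements: the supremum `sup S_Φ fₙ` along an approximating sequence as in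
`IsShiftOfNonneg`. (For a Boolean isomorphism `Φ` it exists and does not depend on the sequence.) -/
def shiftNonneg {μ : Measure A} {ν : Measure B} (Φ : MeasAlg μ → MeasAlg ν)
    (f : LZero μ) : LZero ν :=
  if h : ∃ g, IsShiftOfNonneg Φ f g then h.choose else 0

/-- The shift operator `S_Φ f = S_Φ f₊ - S_Φ f₋`. -/
def shiftOperator {μ : Measure A} {ν : Measure B} (Φ : MeasAlg μ → MeasAlg ν)
    (f : LZero μ) : LZero ν :=
  shiftNonneg Φ (f ⊔ 0) - shiftNonneg Φ ((-f) ⊔ 0)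

/-- Carathéodory functions `N : B × ℝ → ℝ`. -/
structure IsCaratheodory (ν : Measure B) (N : B → ℝ → ℝ) : Prop where
  measurable : ∀ r : ℝ, Measurable fun s => N s r
  continuous : ∀ᵐ s ∂ν, Continuous (N s)

/-- `𝔎`-functions: Carathéodory functions with `N(s, 0) = 0` for almost every `s`. -/
structure IsKFunction (ν : Measure B) (N : B → ℝ → ℝ) : Prop extends IsCaratheodory ν N where
  zero : ∀ᵐ s ∂ν, N s 0 = 0

lemma IsCaratheodory.aestronglyMeasurable_comp {ν : Measure B} {N : B → ℝ → ℝ}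
    (hN : IsCaratheodory ν N) (f : LZero ν) :
    AEStronglyMeasurable (fun s => N s (f s)) ν := by
  obtain ⟨Z, hZ, hZm, hZ0⟩ := exists_measurable_superset_of_null (ae_iff.1 hN.continuous)
  let M : ℝ → B → ℝ := fun r => Zᶜ.indicator (fun s => N s r)
  have hM : StronglyMeasurable (Function.uncurry M) := by
    refine stronglyMeasurable_uncurry_of_continuous_of_stronglyMeasurable (fun s => ?_)
      (fun r => ((hN.measurable r).indicator hZm.compl).stronglyMeasurable)
    by_cases hs : s ∈ Z
    · simp only [M, Set.indicator, Set.mem_compl_iff, hs, not_true_eq_false, if_false]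
      exact continuous_const
    · have hc : Continuous (N s) := by
        by_contra h
        exact hs (hZ h)
      simpa only [M, Set.indicator, Set.mem_compl_iff, hs, not_false_eq_true, if_true] using hc
  refine ⟨fun s => M (f s) s,
    hM.comp_measurable (f.measurable.prodMk measurable_id), ?_⟩
  have hZc : ∀ᵐ s ∂ν, s ∉ Z := measure_eq_zero_iff_ae_notMem.1 hZ0
  filter_upwards [hZc] with s hs
  simp [M, hs]

/-- The superposition (Nemytskii) operator `T_N f = N(·, f(·))`. -/
def superposition {ν : Measure B} (N : B → ℝ → ℝ) (hN : IsCaratheodory ν N) (f : LZero ν) :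
    LZero ν :=
  AEEqFun.mk (fun s => N s (f s)) (hN.aestronglyMeasurable_comp f)

end Operators

end AtomicOperators

end

open AtomicOperators

/-!
The isomorphism `Φ` acts on measurable functions through level sets: call `f : A → X` and
`g : B → X` *intertwined* if `Φ [f ∈ U] = [g ∈ U]` for every measurable `U`. As an isomorphism of
Boolean algebras preserves countable suprema, the admissible `U` form a σ-algebra, so intertwining
passes to countable families and through measurable maps (`Intertwines.prodMk`, `Intertwines.pi`,
`Intertwines.comp`), and every measurable almost everywhere property, such as convergence of a
sequence, is carried from `f` to `g` (`Intertwines.ae_mem`). The shift operator sends `f` to the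
unique function intertwined with it (`Intertwines.shiftOperator`). Hence it respects almost
everywhere convergence, is inverted by the shift operator of `Φ⁻¹`, and carries `π_D` to `π_{Φ D}`.

Continuity for the metrics means that almost everywhere convergent sequences have images with
almost everywhere convergent subsequences (`isRhoContinuous_iff`). This gives at once that a
superposition operator composed with the shift operator is continuous and atomic.

Conversely, for `T` continuous and atomic subordinate to `Φ`, the operator `T ∘ S_{Φ⁻¹}` on `L₀(ν)`
is continuous and commutes with multiplication by characteristic functions, so it only remains to
treat such a local operator `T'`. Its values at the rational constants define `N(s, r)` for rational
`r`. For almost every `s` this is uniformly continuous in `r` on bounded sets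
(`IsLocalOperator.ae_uniformContinuous`): otherwise, on a set of positive measure, a measurable
selection of oscillating pairs of rationals yields two sequences in `L₀(ν)` with the same limit
whose images stay apart. So `N(s, ·)` extends continuously to the reals, and `T' = T_N` holds for
functions with countably many rational values by locality, hence for all functions by continuity.
-/

open Filter Topology

namespace AtomicOperators

/-! ### Boolean isomorphisms of measure algebras -/

section BooleanIso

lemma IsBooleanHom.map_le_iff {P Q : Type*} [BooleanAlgebra P] [BooleanAlgebra Q] {Φ : P → Q}
    (hΦ : IsBooleanHom Φ) (hb : Function.Bijective Φ) (x y : P) : Φ x ≤ Φ y ↔ x ≤ y := by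
  rw [← inf_eq_left, ← hΦ.map_inf, hb.1.eq_iff, inf_eq_left]

/-- A bijective Boolean homomorphism as an order isomorphism. -/
noncomputable def IsBooleanHom.toOrderIso {P Q : Type*} [BooleanAlgebra P] [BooleanAlgebra Q]
    {Φ : P → Q} (hΦ : IsBooleanHom Φ) (hb : Function.Bijective Φ) : P ≃o Q where
  toEquiv := Equiv.ofBijective Φ hb
  map_rel_iff' := hΦ.map_le_iff hb _ _

lemma isBooleanHom_orderIso {P Q : Type*} [BooleanAlgebra P] [BooleanAlgebra Q] (e : P ≃o Q) :
    IsBooleanHom e where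
  map_sup := e.map_sup
  map_inf := e.map_inf
  map_compl x := eq_compl_iff_isCompl.2 (e.isCompl (isCompl_compl (x := x)).symm)

variable {A : Type*} [MeasurableSpace A] {μ : Measure A}

lemma MeasAlg.mk_eq_mk_iff {s t : Set A} {hs : MeasurableSet s} {ht : MeasurableSet t} :
    MeasAlg.mk μ s hs = MeasAlg.mk μ t ht ↔ s =ᵐ[μ] t :=
  ⟨fun h => Quotient.exact h, fun h => Quotient.sound h⟩

lemma MeasAlg.mk_le_mk_iff {s t : Set A} {hs : MeasurableSet s} {ht : MeasurableSet t} :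
    MeasAlg.mk μ s hs ≤ MeasAlg.mk μ t ht ↔ s ≤ᵐ[μ] t := Iff.rfl

lemma MeasAlg.exists_mk (D : MeasAlg μ) : ∃ s, ∃ hs : MeasurableSet s, D = MeasAlg.mk μ s hs := by
  obtain ⟨⟨s, hs⟩, rfl⟩ := Quotient.exists_rep D
  exact ⟨s, hs, rfl⟩

lemma MeasAlg.isLUB_iUnion {s : ℕ → Set A} (hs : ∀ n, MeasurableSet (s n)) :
    IsLUB (Set.range fun n => MeasAlg.mk μ (s n) (hs n))
      (MeasAlg.mk μ (⋃ n, s n) (MeasurableSet.iUnion hs)) := by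
  refine ⟨?_, fun D hD => ?_⟩
  · rintro _ ⟨n, rfl⟩
    exact MeasAlg.mk_le_mk_iff.2 (Eventually.of_forall (Set.subset_iUnion s n))
  · obtain ⟨t, ht, rfl⟩ := MeasAlg.exists_mk D
    have h : ∀ n, s n ≤ᵐ[μ] t := fun n => MeasAlg.mk_le_mk_iff.1 (hD ⟨n, rfl⟩)
    refine MeasAlg.mk_le_mk_iff.2 ?_
    filter_upwards [ae_all_iff.2 h] with x hx hxs
    obtain ⟨n, hn⟩ := Set.mem_iUnion.1 hxs
    exact hx n hn

end BooleanIso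

/-! ### Functions intertwined by an isomorphism of measure algebras -/

section Intertwines

variable {A B : Type*} [MeasurableSpace A] [MeasurableSpace B] {μ : Measure A} {ν : Measure B}
  {X Y : Type*}

/-- The sets `U` whose preimages under `f` and `g` are measurable and correspond to each other
under the isomorphism `Φ`. They form a σ-algebra because an isomorphism of Boolean algebras
preserves all existing suprema, in particular countable unions. -/
@[reducible] def transportSpace (Φ : MeasAlg μ ≃o MeasAlg ν) (f : A → X) (g : B → X) :
    MeasurableSpace X where
  MeasurableSet' U := ∃ (hf : MeasurableSet (f ⁻¹' U)) (hg : MeasurableSet (g ⁻¹' U)),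
    Φ (MeasAlg.mk μ _ hf) = MeasAlg.mk ν _ hg
  measurableSet_empty := ⟨MeasurableSet.empty, MeasurableSet.empty, Φ.map_bot⟩
  measurableSet_compl := by
    rintro U ⟨hf, hg, h⟩
    exact ⟨hf.compl, hg.compl, ((isBooleanHom_orderIso Φ).map_compl _).trans
      (congrArg compl h)⟩
  measurableSet_iUnion := by
    intro U hU
    choose hf hg h using hU
    refine ⟨by rw [Set.preimage_iUnion]; exact MeasurableSet.iUnion hf,
      by rw [Set.preimage_iUnion]; exact MeasurableSet.iUnion hg, ?_⟩
    have h1 := Φ.isLUB_image'.2 (MeasAlg.isLUB_iUnion (μ := μ) hf)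
    rw [← Set.range_comp] at h1
    have h2 := MeasAlg.isLUB_iUnion (μ := ν) hg
    have e : (Φ ∘ fun n => MeasAlg.mk μ (f ⁻¹' U n) (hf n))
        = fun n => MeasAlg.mk ν (g ⁻¹' U n) (hg n) := funext h
    rw [e] at h1
    simp only [Set.preimage_iUnion]
    exact h1.unique h2

/-- `f` and `g` are intertwined by `Φ` if `Φ [f ∈ U] = [g ∈ U]` for every measurable `U`. -/
def Intertwines [m : MeasurableSpace X] (Φ : MeasAlg μ ≃o MeasAlg ν) (f : A → X) (g : B → X) :
    Prop :=
  m ≤ transportSpace Φ f g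

variable [MeasurableSpace X] [MeasurableSpace Y] {Φ : MeasAlg μ ≃o MeasAlg ν}

lemma Intertwines.symm {f : A → X} {g : B → X} (h : Intertwines Φ f g) :
    Intertwines Φ.symm g f := by
  intro U hU
  obtain ⟨hf, hg, e⟩ := h U hU
  exact ⟨hg, hf, by rw [← e, OrderIso.symm_apply_apply]⟩

lemma Intertwines.comp {f : A → X} {g : B → X} (h : Intertwines Φ f g) {k : X → Y}
    (hk : Measurable k) : Intertwines Φ (fun a => k (f a)) (fun b => k (g b)) :=
  fun U hU => h (k ⁻¹' U) (hk hU)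

lemma Intertwines.prodMk {f : A → X} {g : B → X} (h : Intertwines Φ f g) {f' : A → Y}
    {g' : B → Y} (h' : Intertwines Φ f' g') :
    Intertwines Φ (fun a => (f a, f' a)) (fun b => (g b, g' b)) := by
  refine sup_le ?_ ?_
  · rintro _ ⟨U, hU, rfl⟩
    exact h U hU
  · rintro _ ⟨U, hU, rfl⟩
    exact h' U hU

lemma Intertwines.pi {ι : Type*} {f : ι → A → X} {g : ι → B → X}
    (h : ∀ i, Intertwines Φ (f i) (g i)) :
    Intertwines Φ (fun a i => f i a) (fun b i => g i b) := by
  refine iSup_le fun i => ?_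
  rintro _ ⟨U, hU, rfl⟩
  exact h i U hU

lemma Intertwines.congr {f f' : A → X} {g g' : B → X} (h : Intertwines Φ f g)
    (hf' : Measurable f') (hg' : Measurable g') (hf : f =ᵐ[μ] f') (hg : g =ᵐ[ν] g') :
    Intertwines Φ f' g' := by
  intro U hU
  obtain ⟨h1, h2, e⟩ := h U hU
  refine ⟨hf' hU, hg' hU, ?_⟩
  have e1 : MeasAlg.mk μ (f' ⁻¹' U) (hf' hU) = MeasAlg.mk μ (f ⁻¹' U) h1 :=
    MeasAlg.mk_eq_mk_iff.2 (hf.preimage U).symm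
  have e2 : MeasAlg.mk ν (g' ⁻¹' U) (hg' hU) = MeasAlg.mk ν (g ⁻¹' U) h2 :=
    MeasAlg.mk_eq_mk_iff.2 (hg.preimage U).symm
  rw [e1, e2, e]

/-- Measurable properties which hold almost everywhere are transferred by `Φ`. -/
lemma Intertwines.ae_mem {f : A → X} {g : B → X} (h : Intertwines Φ f g) {U : Set X}
    (hU : MeasurableSet U) (hf : ∀ᵐ a ∂μ, f a ∈ U) : ∀ᵐ b ∂ν, g b ∈ U := by
  obtain ⟨h1, h2, e⟩ := h U hU
  have e1 : MeasAlg.mk μ (f ⁻¹' U) h1 = ⊤ :=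
    MeasAlg.mk_eq_mk_iff.2 (eventuallyEq_univ.2 hf)
  rw [e1, Φ.map_top] at e
  exact eventuallyEq_univ.1 (MeasAlg.mk_eq_mk_iff.1 e.symm)

lemma Intertwines.ae_eq {f f' : A → ℝ} {g g' : B → ℝ} (h : Intertwines Φ f g)
    (h' : Intertwines Φ f' g') (hf : f =ᵐ[μ] f') : g =ᵐ[ν] g' :=
  (h.prodMk h').ae_mem (measurableSet_eq_fun measurable_fst measurable_snd) hf

lemma Intertwines.ae_le {f f' : A → ℝ} {g g' : B → ℝ} (h : Intertwines Φ f g)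
    (h' : Intertwines Φ f' g') (hf : f ≤ᵐ[μ] f') : g ≤ᵐ[ν] g' :=
  (h.prodMk h').ae_mem (measurableSet_le measurable_fst measurable_snd) hf

lemma Intertwines.ae_tendsto {f : ℕ → A → ℝ} {g : ℕ → B → ℝ} (h : ∀ n, Intertwines Φ (f n) (g n))
    {f' : A → ℝ} {g' : B → ℝ} (h' : Intertwines Φ f' g')
    (hf : ∀ᵐ a ∂μ, Tendsto (fun n => f n a) atTop (𝓝 (f' a))) :
    ∀ᵐ b ∂ν, Tendsto (fun n => g n b) atTop (𝓝 (g' b)) := by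
  have hU : MeasurableSet {p : (ℕ → ℝ) × ℝ | Tendsto (fun n => p.1 n) atTop (𝓝 p.2)} :=
    measurableSet_tendsto_fun (fun n => (measurable_pi_apply n).comp measurable_fst)
      measurable_snd
  exact ((Intertwines.pi h).prodMk h').ae_mem hU hf

/-- Convergence to some finite limit is transferred; this yields the existence of the suprema
defining the shift operator. -/
lemma Intertwines.ae_exists_tendsto {f : ℕ → A → ℝ} {g : ℕ → B → ℝ}
    (h : ∀ n, Intertwines Φ (f n) (g n))
    (hf : ∀ᵐ a ∂μ, ∃ c, Tendsto (fun n => f n a) atTop (𝓝 c)) :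
    ∀ᵐ b ∂ν, ∃ c, Tendsto (fun n => g n b) atTop (𝓝 c) := by
  have hU : MeasurableSet {p : ℕ → ℝ | ∃ c, Tendsto (fun n => p n) atTop (𝓝 c)} :=
    measurableSet_exists_tendsto (fun n => measurable_pi_apply n)
  exact (Intertwines.pi h).ae_mem hU hf

/-- Intertwining passes to almost everywhere limits. The limit is written as the `limsup`, a
measurable function of the whole sequence. -/
lemma Intertwines.of_tendsto {f : ℕ → A → ℝ} {g : ℕ → B → ℝ} (h : ∀ n, Intertwines Φ (f n) (g n))
    {f' : A → ℝ} {g' : B → ℝ} (mf : Measurable f') (mg : Measurable g')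
    (hf : ∀ᵐ a ∂μ, Tendsto (fun n => f n a) atTop (𝓝 (f' a)))
    (hg : ∀ᵐ b ∂ν, Tendsto (fun n => g n b) atTop (𝓝 (g' b))) : Intertwines Φ f' g' := by
  have hk : Measurable fun p : ℕ → ℝ => limsup (fun n => p n) atTop :=
    Measurable.limsup fun n => measurable_pi_apply n
  refine ((Intertwines.pi h).comp hk).congr mf mg ?_ ?_
  · filter_upwards [hf] with a ha using ha.limsup_eq
  · filter_upwards [hg] with b hb using hb.limsup_eq

lemma Intertwines.indicator_one {s : Set A} {t : Set B} (hs : MeasurableSet s)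
    (ht : MeasurableSet t) (h : Φ (MeasAlg.mk μ s hs) = MeasAlg.mk ν t ht) :
    Intertwines Φ (s.indicator fun _ => (1 : ℝ)) (t.indicator fun _ => (1 : ℝ)) := by
  have hp : Intertwines Φ (fun a => a ∈ s) (fun b => b ∈ t) := by
    intro U _
    -- every set of truth values is a Boolean combination of `{True}`
    have hT : MeasurableSet[transportSpace Φ (fun a => a ∈ s) (fun b => b ∈ t)] {True} := by
      have es : (fun a => a ∈ s) ⁻¹' {True} = s := by ext; simp
      have et : (fun a => a ∈ t) ⁻¹' {True} = t := by ext; simp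
      refine ⟨by rwa [es], by rwa [et], ?_⟩
      simp only [es, et, h]
    by_cases h1 : True ∈ U <;> by_cases h2 : False ∈ U
    · have : U = Set.univ := by ext p; by_cases hp : p <;> simp [hp, h1, h2]
      rw [this]; exact @MeasurableSet.univ _ (transportSpace _ _ _)
    · have : U = {True} := by ext p; by_cases hp : p <;> simp [hp, h1, h2]
      rw [this]; exact hT
    · have : U = {True}ᶜ := by ext p; by_cases hp : p <;> simp [hp, h1, h2]
      rw [this]; exact hT.compl
    · have : U = ∅ := by ext p; by_cases hp : p <;> simp [hp, h1, h2]
      rw [this]; exact @MeasurableSet.empty _ (transportSpace _ _ _)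
  classical
  have := hp.comp (k := fun p : Prop => if p then (1 : ℝ) else 0) (Measurable.of_discrete)
  convert this using 1
  · ext a; simp [Set.indicator_apply]
  · ext b; simp [Set.indicator_apply]

end Intertwines

/-! ### The shift operator -/

section Shift

variable {A B : Type*} [MeasurableSpace A] [MeasurableSpace B] {μ : Measure A} {ν : Measure B}
  {Φ : MeasAlg μ ≃o MeasAlg ν}

lemma Intertwines.coeFn_congr {f : A → ℝ} {g : B → ℝ} {f' : LZero μ} {g' : LZero ν}
    (h : Intertwines Φ f g) (hf : f' =ᵐ[μ] f) (hg : g' =ᵐ[ν] g) : Intertwines Φ f' g' :=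
  h.congr f'.measurable g'.measurable hf.symm hg.symm

lemma Intertwines.chi (D : MeasAlg μ) : Intertwines Φ (chi D : LZero μ) (chi (Φ D) : LZero ν) := by
  obtain ⟨s, hs, rfl⟩ := D.exists_mk
  obtain ⟨t, ht, h⟩ := (Φ (MeasAlg.mk μ s hs)).exists_mk
  rw [h]
  exact (Intertwines.indicator_one hs ht h).coeFn_congr (coeFn_chi_mk s hs) (coeFn_chi_mk t ht)

lemma Intertwines.smul {f : LZero μ} {g : LZero ν} (h : Intertwines Φ f g) (c : ℝ) :
    Intertwines Φ (c • f : LZero μ) (c • g : LZero ν) :=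
  (h.comp (measurable_const_mul c)).coeFn_congr (AEEqFun.coeFn_smul c f) (AEEqFun.coeFn_smul c g)

lemma Intertwines.add {f f' : LZero μ} {g g' : LZero ν} (h : Intertwines Φ f g)
    (h' : Intertwines Φ f' g') : Intertwines Φ (f + f' : LZero μ) (g + g' : LZero ν) :=
  ((h.prodMk h').comp (measurable_fst.add measurable_snd)).coeFn_congr
    (AEEqFun.coeFn_add f f') (AEEqFun.coeFn_add g g')

lemma Intertwines.sub {f f' : LZero μ} {g g' : LZero ν} (h : Intertwines Φ f g)
    (h' : Intertwines Φ f' g') : Intertwines Φ (f - f' : LZero μ) (g - g' : LZero ν) :=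
  ((h.prodMk h').comp (measurable_fst.sub measurable_snd)).coeFn_congr
    (AEEqFun.coeFn_sub f f') (AEEqFun.coeFn_sub g g')

lemma Intertwines.mul {f f' : LZero μ} {g g' : LZero ν} (h : Intertwines Φ f g)
    (h' : Intertwines Φ f' g') : Intertwines Φ (f * f' : LZero μ) (g * g' : LZero ν) :=
  ((h.prodMk h').comp (measurable_fst.mul measurable_snd)).coeFn_congr
    (AEEqFun.coeFn_mul f f') (AEEqFun.coeFn_mul g g')

lemma Intertwines.zero : Intertwines Φ (0 : LZero μ) (0 : LZero ν) := by
  have h := (Intertwines.chi (Φ := Φ) ⊥).smul 0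
  rwa [zero_smul, zero_smul] at h

lemma Intertwines.sum {ι : Type*} (s : Finset ι) {f : ι → LZero μ} {g : ι → LZero ν}
    (h : ∀ i ∈ s, Intertwines Φ (f i) (g i)) :
    Intertwines Φ (∑ i ∈ s, f i : LZero μ) (∑ i ∈ s, g i : LZero ν) := by
  classical
  induction s using Finset.induction_on with
  | empty => exact Intertwines.zero
  | insert i s hi ih =>
    rw [Finset.sum_insert hi, Finset.sum_insert hi]
    exact (h i (Finset.mem_insert_self i s)).add
      (ih fun j hj => h j (Finset.mem_insert_of_mem hj))

/-- An element of `L₀(ν)` is determined by the element of `L₀(μ)` it is intertwined with. -/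
lemma Intertwines.right_unique {f : LZero μ} {g g' : LZero ν} (h : Intertwines Φ f g)
    (h' : Intertwines Φ f g') : g = g' :=
  AEEqFun.ext (h.ae_eq h' (ae_eq_refl _))

lemma coeFn_finset_sum {ι : Type*} (s : Finset ι) (f : ι → LZero μ) :
    (∑ i ∈ s, f i : LZero μ) =ᵐ[μ] fun a => ∑ i ∈ s, f i a := by
  classical
  induction s using Finset.induction_on with
  | empty => exact AEEqFun.coeFn_zero (μ := μ) (β := ℝ)
  | insert i s hi ih =>
    rw [Finset.sum_insert hi]
    filter_upwards [AEEqFun.coeFn_add (f i) (∑ j ∈ s, f j), ih] with a h1 h2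
    rw [h1, Pi.add_apply, h2, Finset.sum_insert hi]

/-- The canonical representation of a simple function over its level sets. -/
lemma simpleClass_eq_sum (φ : SimpleFunc A ℝ) :
    simpleClass μ φ =
      ∑ r ∈ φ.range, r • chi (MeasAlg.mk μ (φ ⁻¹' {r}) (φ.measurableSet_fiber r)) := by
  refine AEEqFun.ext ?_
  have h1 : ∀ r : φ.range, (r.1 • chi (MeasAlg.mk μ (φ ⁻¹' {r.1}) (φ.measurableSet_fiber r.1)) :
      LZero μ) =ᵐ[μ] fun a => r.1 * (φ ⁻¹' {r.1}).indicator (fun _ => (1 : ℝ)) a := by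
    intro r
    filter_upwards [AEEqFun.coeFn_smul r.1 (chi (MeasAlg.mk μ _ (φ.measurableSet_fiber r.1))),
      coeFn_chi_mk (μ := μ) _ (φ.measurableSet_fiber r.1)] with a h1 h2
    rw [h1, Pi.smul_apply, h2, smul_eq_mul]
  filter_upwards [coeFn_finset_sum (μ := μ) φ.range _, ae_all_iff.2 h1,
    AEEqFun.coeFn_mk (μ := μ) φ φ.aestronglyMeasurable] with a h2 h3 h4
  have h5 : ∀ r ∈ φ.range, (r • chi (MeasAlg.mk μ (φ ⁻¹' {r}) (φ.measurableSet_fiber r)) :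
      LZero μ) a = r * (φ ⁻¹' {r}).indicator (fun _ => (1 : ℝ)) a := fun r hr => h3 ⟨r, hr⟩
  rw [h2, simpleClass, h4, Finset.sum_congr rfl h5, Finset.sum_eq_single (φ a)]
  · simp
  · intro r _ hr
    rw [Set.indicator_of_notMem (by simpa using hr.symm), mul_zero]
  · intro h
    exact absurd (φ.mem_range_self a) h

lemma Intertwines.simple (φ : SimpleFunc A ℝ) :
    Intertwines Φ (simpleClass μ φ) (shiftSimple Φ φ) := by
  rw [simpleClass_eq_sum, shiftSimple]
  exact Intertwines.sum _ fun r _ => (Intertwines.chi _).smul r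

/-- In `L₀`, a supremum of an increasing sequence is a pointwise limit almost everywhere. -/
lemma ae_tendsto_of_isLUB {g : ℕ → LZero ν} {g' : LZero ν} (hm : ∀ n, g n ≤ g (n + 1))
    (hg : IsLUB (Set.range g) g') : ∀ᵐ b ∂ν, Tendsto (fun n => g n b) atTop (𝓝 (g' b)) := by
  have hm' : ∀ᵐ b ∂ν, ∀ n, g n b ≤ g (n + 1) b :=
    ae_all_iff.2 fun n => AEEqFun.coeFn_le.2 (hm n)
  have hle : ∀ᵐ b ∂ν, ∀ n, g n b ≤ g' b :=
    ae_all_iff.2 fun n => AEEqFun.coeFn_le.2 (hg.1 ⟨n, rfl⟩)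
  have hlim : ∀ᵐ b ∂ν, Tendsto (fun n => g n b) atTop (𝓝 (⨆ n, g n b)) := by
    filter_upwards [hm', hle] with b h1 h2
    exact tendsto_atTop_ciSup (monotone_nat_of_le_succ h1)
      ⟨g' b, by rintro _ ⟨n, rfl⟩; exact h2 n⟩
  have hsm : Measurable fun b => ⨆ n, g n b := Measurable.iSup fun n => (g n).measurable
  have hmk := AEEqFun.coeFn_mk (μ := ν) _ hsm.aestronglyMeasurable
  have hub : g' ≤ AEEqFun.mk _ hsm.aestronglyMeasurable := by
    refine hg.2 ?_
    rintro _ ⟨n, rfl⟩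
    rw [← AEEqFun.coeFn_le]
    filter_upwards [hmk, hle] with b h1 h2
    rw [h1]
    exact le_ciSup (f := fun n => g n b) ⟨g' b, by rintro _ ⟨n, rfl⟩; exact h2 n⟩ n
  filter_upwards [hlim, hmk, AEEqFun.coeFn_le.2 hub, hle] with b h1 h2 h3 h4
  have : g' b = ⨆ n, g n b := le_antisymm (h2 ▸ h3) (ciSup_le h4)
  rwa [this]

lemma isLUB_of_ae_tendsto {g : ℕ → LZero ν} {g' : LZero ν} (hm : ∀ n, g n ≤ g (n + 1))
    (hg : ∀ᵐ b ∂ν, Tendsto (fun n => g n b) atTop (𝓝 (g' b))) : IsLUB (Set.range g) g' := by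
  have hm' : ∀ᵐ b ∂ν, ∀ n, g n b ≤ g (n + 1) b :=
    ae_all_iff.2 fun n => AEEqFun.coeFn_le.2 (hm n)
  refine ⟨?_, fun u hu => ?_⟩
  · rintro _ ⟨n, rfl⟩
    rw [← AEEqFun.coeFn_le]
    filter_upwards [hm', hg] with b h1 h2
    exact (monotone_nat_of_le_succ h1).ge_of_tendsto h2 n
  · have hle : ∀ᵐ b ∂ν, ∀ n, g n b ≤ u b :=
      ae_all_iff.2 fun n => AEEqFun.coeFn_le.2 (hu ⟨n, rfl⟩)
    rw [← AEEqFun.coeFn_le]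
    filter_upwards [hle, hg] with b h1 h2
    exact le_of_tendsto' h2 h1

lemma simpleClass_mono {φ ψ : SimpleFunc A ℝ} (h : φ ≤ ψ) :
    simpleClass μ φ ≤ simpleClass μ ψ :=
  (AEEqFun.mk_le_mk _ _).2 (Eventually.of_forall h)

lemma shiftSimple_mono {φ ψ : SimpleFunc A ℝ} (h : φ ≤ ψ) :
    shiftSimple Φ φ ≤ shiftSimple Φ ψ := by
  rw [← AEEqFun.coeFn_le]
  exact (Intertwines.simple φ).ae_le (Intertwines.simple ψ)
    (AEEqFun.coeFn_le.2 (simpleClass_mono h))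

lemma IsShiftOfNonneg.intertwines {f : LZero μ} {g : LZero ν} (h : IsShiftOfNonneg Φ f g) :
    Intertwines Φ f g := by
  obtain ⟨φ, -, hm, hf, hg⟩ := h
  refine Intertwines.of_tendsto (fun n => Intertwines.simple (φ n)) f.measurable g.measurable
    (ae_tendsto_of_isLUB (fun n => simpleClass_mono (hm n.le_succ)) hf)
    (ae_tendsto_of_isLUB (fun n => shiftSimple_mono (hm n.le_succ)) hg)

/-- A nonnegative measurable function is an increasing pointwise limit of nonnegative real simple
functions. -/
lemma exists_monotone_simpleFunc_tendsto {f : A → ℝ} (hf : Measurable f) :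
    ∃ φ : ℕ → SimpleFunc A ℝ, (∀ n, 0 ≤ φ n) ∧ Monotone φ ∧
      ∀ a, 0 ≤ f a → Tendsto (fun n => φ n a) atTop (𝓝 (f a)) := by
  have lt (n a) := SimpleFunc.eapprox_lt_top (fun a => ENNReal.ofReal (f a)) n a
  refine ⟨fun n => (SimpleFunc.eapprox (fun a => ENNReal.ofReal (f a)) n).map ENNReal.toReal,
    fun n a => ENNReal.toReal_nonneg, fun m n h a => ?_, fun a ha => ?_⟩
  · exact ENNReal.toReal_mono (lt n a).ne (SimpleFunc.monotone_eapprox _ h a)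
  · have h := SimpleFunc.tendsto_eapprox hf.ennreal_ofReal a
    have h2 := (ENNReal.tendsto_toReal ENNReal.ofReal_ne_top).comp h
    rwa [ENNReal.toReal_ofReal ha] at h2

lemma exists_isShiftOfNonneg {f : LZero μ} (hf : 0 ≤ f) : ∃ g, IsShiftOfNonneg Φ f g := by
  obtain ⟨φ, h0, hm, hlim⟩ := exists_monotone_simpleFunc_tendsto f.measurable
  have hmk : ∀ᵐ a ∂μ, ∀ n, simpleClass μ (φ n) a = φ n a :=
    ae_all_iff.2 fun n => AEEqFun.coeFn_mk _ _
  have hφ : ∀ᵐ a ∂μ, Tendsto (fun n => simpleClass μ (φ n) a) atTop (𝓝 (f a)) := by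
    filter_upwards [hmk, LZero.nonneg_iff.1 hf] with a h1 h2
    simpa only [h1] using hlim a h2
  obtain ⟨g, mg, hg⟩ := measurable_limit_of_tendsto_metrizable_ae
    (fun n => (shiftSimple Φ (φ n)).measurable.aemeasurable)
    (Intertwines.ae_exists_tendsto (fun n => Intertwines.simple (Φ := Φ) (φ n))
      (hφ.mono fun a ha => ⟨_, ha⟩))
  refine ⟨AEEqFun.mk g mg.aestronglyMeasurable, φ, h0, hm,
    isLUB_of_ae_tendsto (fun n => simpleClass_mono (hm n.le_succ)) hφ,
    isLUB_of_ae_tendsto (fun n => shiftSimple_mono (hm n.le_succ)) ?_⟩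
  filter_upwards [hg, AEEqFun.coeFn_mk g mg.aestronglyMeasurable] with b h1 h2
  rwa [h2]

lemma Intertwines.shiftNonneg {f : LZero μ} (hf : 0 ≤ f) : Intertwines Φ f (shiftNonneg Φ f) := by
  have h := exists_isShiftOfNonneg (Φ := Φ) hf
  rw [AtomicOperators.shiftNonneg, dif_pos h]
  exact h.choose_spec.intertwines

lemma sup_zero_sub_neg_sup_zero (f : LZero μ) : f ⊔ 0 - (-f) ⊔ 0 = f := by
  refine AEEqFun.ext ?_
  filter_upwards [AEEqFun.coeFn_sub (f ⊔ 0) ((-f) ⊔ 0), AEEqFun.coeFn_sup f 0,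
    AEEqFun.coeFn_sup (-f) 0, AEEqFun.coeFn_neg f,
    AEEqFun.coeFn_zero (μ := μ) (β := ℝ)] with s h1 h2 h3 h4 h5
  rw [h1, Pi.sub_apply, h2, h3, h4, h5, Pi.neg_apply, Pi.zero_apply]
  exact max_zero_sub_max_neg_zero_eq_self (f s)

/-- The shift operator is characterised by `[S_Φ f ∈ U] = Φ [f ∈ U]` for Borel sets `U`. -/
lemma Intertwines.shiftOperator (f : LZero μ) : Intertwines Φ f (shiftOperator Φ f) := by
  have h := (Intertwines.shiftNonneg (Φ := Φ) (f := f ⊔ 0) le_sup_right).sub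
    (Intertwines.shiftNonneg (Φ := Φ) (f := (-f) ⊔ 0) le_sup_right)
  rwa [sup_zero_sub_neg_sup_zero] at h

lemma shiftOperator_mulChi (D : MeasAlg μ) (f : LZero μ) :
    shiftOperator Φ (mulChi D f) = mulChi (Φ D) (shiftOperator Φ f) :=
  (Intertwines.shiftOperator _).right_unique
    ((Intertwines.chi D).mul (Intertwines.shiftOperator f))

lemma shiftOperator_symm_shiftOperator (f : LZero μ) :
    shiftOperator Φ.symm (shiftOperator Φ f) = f :=
  (Intertwines.shiftOperator _).right_unique (Intertwines.shiftOperator f).symm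

lemma ae_tendsto_shiftOperator {f : ℕ → LZero μ} {f' : LZero μ}
    (h : ∀ᵐ a ∂μ, Tendsto (fun n => f n a) atTop (𝓝 (f' a))) :
    ∀ᵐ b ∂ν, Tendsto (fun n => shiftOperator Φ (f n) b) atTop (𝓝 (shiftOperator Φ f' b)) :=
  Intertwines.ae_tendsto (fun n => Intertwines.shiftOperator (f n))
    (Intertwines.shiftOperator f') h

end Shift

/-! ### Continuity in measure in terms of almost everywhere convergence -/

section Convergence

variable {A B : Type*} [MeasurableSpace A] [MeasurableSpace B] {μ : Measure A} {ν : Measure B}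

lemma measurable_rho_integrand (f g : LZero μ) :
    Measurable fun s => |f s - g s| / (1 + |f s - g s|) := by
  have h : Measurable fun s => |f s - g s| := (f.measurable.sub g.measurable).abs
  exact h.div (h.const_add 1)

lemma abs_div_one_add_abs_mem_Icc (x : ℝ) : |x| / (1 + |x|) ∈ Set.Icc (0 : ℝ) 1 :=
  ⟨by positivity, (div_le_one (by positivity)).2 (by linarith)⟩

lemma rhoLZero_nonneg (lam : Measure A) (f g : LZero μ) : 0 ≤ rhoLZero lam f g :=
  integral_nonneg fun s => (abs_div_one_add_abs_mem_Icc (f s - g s)).1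

lemma tendsto_rhoLZero_of_ae {lam : Measure A} [IsFiniteMeasure lam] (h : lam ≪ μ)
    {g : ℕ → LZero μ} {f : LZero μ}
    (hg : ∀ᵐ a ∂μ, Tendsto (fun n => g n a) atTop (𝓝 (f a))) :
    Tendsto (fun n => rhoLZero lam (g n) f) atTop (𝓝 0) := by
  have key := tendsto_integral_of_dominated_convergence (μ := lam)
    (F := fun n s => |g n s - f s| / (1 + |g n s - f s|)) (f := fun _ => (0 : ℝ)) (fun _ => (1 : ℝ))
    (fun n => (measurable_rho_integrand (g n) f).aestronglyMeasurable) (integrable_const 1)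
    (fun n => Eventually.of_forall fun s => by
      obtain ⟨h0, h1⟩ := abs_div_one_add_abs_mem_Icc (g n s - f s)
      rwa [Real.norm_eq_abs, abs_of_nonneg h0]) ?_
  · simpa [rhoLZero] using key
  · filter_upwards [h.ae_le hg] with a ha
    have h1 : Tendsto (fun n => |g n a - f a|) atTop (𝓝 0) := by
      simpa using (ha.sub_const (f a)).abs
    have h2 := h1.div (h1.const_add 1) (by norm_num)
    rwa [zero_div] at h2

lemma exists_subseq_ae_of_tendsto_rhoLZero {lam : Measure A} [IsFiniteMeasure lam] (h : μ ≪ lam)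
    {g : ℕ → LZero μ} {f : LZero μ} (hg : Tendsto (fun n => rhoLZero lam (g n) f) atTop (𝓝 0)) :
    ∃ ns : ℕ → ℕ, StrictMono ns ∧ ∀ᵐ a ∂μ, Tendsto (fun j => g (ns j) a) atTop (𝓝 (f a)) := by
  let F : ℕ → A → ℝ := fun n s => |g n s - f s| / (1 + |g n s - f s|)
  have hFm : ∀ n, Measurable (F n) := fun n => measurable_rho_integrand (g n) f
  have hint : ∀ n, Integrable (F n) lam := fun n =>
    Integrable.of_bound (hFm n).aestronglyMeasurable 1 (Eventually.of_forall fun s => by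
      obtain ⟨h0, h1⟩ := abs_div_one_add_abs_mem_Icc (g n s - f s)
      rwa [Real.norm_eq_abs, abs_of_nonneg h0])
  have hL : Tendsto (fun n => eLpNorm (F n - 0) 1 lam) atTop (𝓝 0) := by
    have e : ∀ n, eLpNorm (F n - 0) 1 lam = ENNReal.ofReal (rhoLZero lam (g n) f) := by
      intro n
      rw [sub_zero, eLpNorm_one_eq_lintegral_enorm, ← ofReal_integral_norm_eq_lintegral_enorm
        (hint n)]
      congr 1
      refine integral_congr_ae (Eventually.of_forall fun s => ?_)
      exact abs_of_nonneg (abs_div_one_add_abs_mem_Icc (g n s - f s)).1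
    simp only [e]
    simpa using ENNReal.tendsto_ofReal hg
  obtain ⟨ns, hns, hlim⟩ := (tendstoInMeasure_of_tendsto_eLpNorm (one_ne_zero)
    (fun n => (hFm n).aestronglyMeasurable) aestronglyMeasurable_zero hL).exists_seq_tendsto_ae
  refine ⟨ns, hns, ?_⟩
  filter_upwards [h.ae_le hlim] with a ha
  -- `u ↦ u / (1 + u)` is inverted by `v ↦ v / (1 - v)`
  have h0 : Tendsto (fun j => F (ns j) a) atTop (𝓝 0) := ha
  have h1 : Tendsto (fun j => F (ns j) a / (1 - F (ns j) a)) atTop (𝓝 0) := by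
    have h2 := h0.div (h0.const_sub 1) (by norm_num)
    rwa [zero_div] at h2
  have h2 : ∀ j, F (ns j) a / (1 - F (ns j) a) = |g (ns j) a - f a| := by
    intro j
    have : 1 + |g (ns j) a - f a| ≠ 0 := by positivity
    simp only [F]
    field_simp
    ring
  simp only [h2] at h1
  exact tendsto_iff_norm_sub_tendsto_zero.2 h1

/-- Continuity with respect to convergence in measure, phrased without a choice of finite measure:
almost everywhere convergent sequences are mapped to sequences with an almost everywhere convergent
subsequence with the right limit. -/
def IsSubseqContinuous (T : LZero μ → LZero ν) : Prop :=
  ∀ (g : ℕ → LZero μ) (f : LZero μ), (∀ᵐ a ∂μ, Tendsto (fun n => g n a) atTop (𝓝 (f a))) →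
    ∃ ns : ℕ → ℕ, StrictMono ns ∧
      ∀ᵐ b ∂ν, Tendsto (fun j => T (g (ns j)) b) atTop (𝓝 (T f b))

/-- The metrics enter only through convergence in measure, so that `lamA` and `lamB` disappear. -/
lemma isRhoContinuous_iff {lamA : Measure A} {lamB : Measure B} [IsFiniteMeasure lamA]
    [IsFiniteMeasure lamB] (hA : lamA ≪ μ) (hA' : μ ≪ lamA) (hB : lamB ≪ ν) (hB' : ν ≪ lamB)
    (T : LZero μ → LZero ν) : IsRhoContinuous lamA lamB T ↔ IsSubseqContinuous T := by
  constructor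
  · intro hT g f hg
    refine exists_subseq_ae_of_tendsto_rhoLZero (g := fun n => T (g n)) hB'
      (Metric.tendsto_atTop.2 fun ε hε => ?_)
    obtain ⟨δ, hδ, h⟩ := hT f ε hε
    obtain ⟨n, hn⟩ := Metric.tendsto_atTop.1 (tendsto_rhoLZero_of_ae hA hg) δ hδ
    refine ⟨n, fun m hm => ?_⟩
    have h1 := hn m hm
    rw [Real.dist_0_eq_abs, abs_of_nonneg (rhoLZero_nonneg _ _ _)] at h1
    rw [Real.dist_0_eq_abs, abs_of_nonneg (rhoLZero_nonneg _ _ _)]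
    exact h _ h1
  · intro hT f ε hε
    by_contra! hcon
    choose g hg hTg using fun n : ℕ => hcon (1 / ((n : ℝ) + 1)) (by positivity)
    have h0 : Tendsto (fun n => rhoLZero lamA (g n) f) atTop (𝓝 0) :=
      squeeze_zero (fun n => rhoLZero_nonneg _ _ _) (fun n => (hg n).le)
        tendsto_one_div_add_atTop_nhds_zero_nat
    obtain ⟨ns, -, h1⟩ := exists_subseq_ae_of_tendsto_rhoLZero hA' h0
    obtain ⟨ms, -, h2⟩ := hT (fun j => g (ns j)) f h1
    have h3 := tendsto_rhoLZero_of_ae (g := fun j => T (g (ns (ms j)))) hB h2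
    exact absurd (ge_of_tendsto' h3 fun j => hTg _) (not_le.2 hε)

end Convergence

/-! ### Local operators on `L₀` which are continuous in measure -/

section LocalOperators

variable {B : Type*} [MeasurableSpace B] {ν : Measure B}

/-- Operators commuting with the multiplications by characteristic functions. -/
def IsLocalOperator (T : LZero ν → LZero ν) : Prop :=
  ∀ (D : MeasAlg ν) (g : LZero ν), T (mulChi D g) = mulChi D (T g)

lemma IsLocalOperator.ae_eq_on {T : LZero ν → LZero ν} (hT : IsLocalOperator T) {D : Set B}
    (hD : MeasurableSet D) {g g' : LZero ν} (h : ∀ᵐ s ∂ν, s ∈ D → g s = g' s) :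
    ∀ᵐ s ∂ν, s ∈ D → T g s = T g' s := by
  have e : mulChi (MeasAlg.mk ν D hD) g = mulChi (MeasAlg.mk ν D hD) g' := by
    refine AEEqFun.ext ?_
    filter_upwards [h, coeFn_mulChi_mk D hD g, coeFn_mulChi_mk D hD g'] with s h1 h2 h3
    rw [h2, h3]
    by_cases hs : s ∈ D
    · simp [hs, h1 hs]
    · simp [hs]
  have e' := hT (MeasAlg.mk ν D hD) g
  rw [e, hT] at e'
  filter_upwards [coeFn_mulChi_mk D hD (T g), coeFn_mulChi_mk D hD (T g')] with s h1 h2 hs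
  rw [← e', h2] at h1
  simpa [hs] using h1.symm

lemma IsLocalOperator.map_zero {T : LZero ν → LZero ν} (hT : IsLocalOperator T) : T 0 = 0 := by
  have h : ∀ g : LZero ν, mulChi ⊥ g = 0 := by
    intro g
    refine AEEqFun.ext ?_
    filter_upwards [coeFn_mulChi_mk ∅ MeasurableSet.empty g,
      AEEqFun.coeFn_zero (μ := ν) (β := ℝ)] with s h1 h2
    rw [h2]
    exact h1.trans (by simp)
  simpa [h] using hT ⊥ 0

/-- On functions with countably many values a local operator is determined pointwise by its values
at the constants. -/
lemma IsLocalOperator.ae_eq_of_countable {T : LZero ν → LZero ν} (hT : IsLocalOperator T)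
    {ι : Type*} [Countable ι] [MeasurableSpace ι] [MeasurableSingletonClass ι] {n : B → ι}
    (hn : Measurable n) (c : ι → ℝ) {g : LZero ν} {D : Set B} (hD : MeasurableSet D)
    (hg : ∀ᵐ s ∂ν, s ∈ D → g s = c (n s)) :
    ∀ᵐ s ∂ν, s ∈ D → T g s = T (AEEqFun.const B (c (n s))) s := by
  have h : ∀ i, ∀ᵐ s ∂ν, s ∈ D ∩ n ⁻¹' {i} → T g s = T (AEEqFun.const B (c i)) s := by
    intro i
    refine hT.ae_eq_on (hD.inter (hn (measurableSet_singleton i))) ?_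
    filter_upwards [hg, AEEqFun.coeFn_const (μ := ν) B (c i)] with s h1 h2 hs
    rw [h1 hs.1, h2, show n s = i from hs.2, Function.const]
  filter_upwards [ae_all_iff.2 h] with s hs hsD
  exact hs (n s) ⟨hsD, rfl⟩

/-- The points at which a family of functions indexed by the rationals has oscillation at least `ε`
over pairs of rationals in `[-M, M]` at arbitrarily small distance. -/
def oscillationSet (N : ℚ → B → ℝ) (M : ℕ) (ε : ℝ) : Set B :=
  {s | ∀ k : ℕ, ∃ p : ℚ × ℚ, (|(p.1 : ℝ)| ≤ M ∧ |(p.2 : ℝ)| ≤ M ∧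
    |(p.1 : ℝ) - p.2| ≤ 1 / ((k : ℝ) + 1)) ∧ ε ≤ |N p.1 s - N p.2 s|}

/-- Measurable selection of oscillating pairs `(a (n k s), b (n k s))`. If the first coordinates
are chosen almost minimal, both coordinates converge as `k → ∞`, since the infima increase. -/
lemma exists_oscillation_selection {N : ℚ → B → ℝ} (hN : ∀ r, Measurable (N r)) (M : ℕ) (ε : ℝ) :
    MeasurableSet (oscillationSet N M ε) ∧
    ∃ (a b : ℕ → ℚ) (n : ℕ → B → ℕ) (y : B → ℝ), (∀ k, Measurable (n k)) ∧ Measurable y ∧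
      ∀ s ∈ oscillationSet N M ε,
        Tendsto (fun k => (a (n k s) : ℝ)) atTop (𝓝 (y s)) ∧
        Tendsto (fun k => (b (n k s) : ℝ)) atTop (𝓝 (y s)) ∧
        ∀ k, ε ≤ |N (a (n k s)) s - N (b (n k s)) s| := by
  classical
  let bad : ℕ → B → ℚ × ℚ → Prop := fun k s p =>
    (|(p.1 : ℝ)| ≤ M ∧ |(p.2 : ℝ)| ≤ M ∧ |(p.1 : ℝ) - p.2| ≤ 1 / ((k : ℝ) + 1)) ∧
      ε ≤ |N p.1 s - N p.2 s|
  have hbad : ∀ k p, MeasurableSet {s | bad k s p} := by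
    intro k p
    have hd : Measurable fun s => |N p.1 s - N p.2 s| := ((hN _).sub (hN _)).abs
    exact (MeasurableSet.const _).inter (measurableSet_le measurable_const hd)
  let E : Set B := oscillationSet N M ε
  have hE : MeasurableSet E := by
    have : E = ⋂ k, ⋃ p, {s | bad k s p} := by
      ext s; simp [E, oscillationSet, bad]
    rw [this]
    exact MeasurableSet.iInter fun k => MeasurableSet.iUnion fun p => hbad k p
  -- the infimum of the first coordinates of bad pairs
  let z : ℕ → B → ℚ × ℚ → ℝ := fun k s p => if bad k s p then (p.1 : ℝ) else M
  let y : ℕ → B → ℝ := fun k s => ⨅ p, z k s p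
  have hz : ∀ k s p, -(M : ℝ) ≤ z k s p := by
    intro k s p
    by_cases h : bad k s p
    · simpa [z, h] using (abs_le.1 h.1.1).1
    · have : (0 : ℝ) ≤ M := Nat.cast_nonneg M
      simp only [z, h, if_false]
      linarith
  have hz' : ∀ k s p, z k s p ≤ M := by
    intro k s p
    by_cases h : bad k s p
    · simpa [z, h] using (abs_le.1 h.1.1).2
    · simp [z, h]
  have hbdd : ∀ k s, BddBelow (Set.range (z k s)) := fun k s =>
    ⟨-M, by rintro _ ⟨p, rfl⟩; exact hz k s p⟩
  have hym : ∀ k, Measurable (y k) := fun k =>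
    Measurable.iInf fun p => Measurable.ite (hbad k p) measurable_const measurable_const
  have hymono : ∀ s, Monotone fun k => y k s := by
    intro s
    refine monotone_nat_of_le_succ fun k => ciInf_mono (hbdd k s) fun p => ?_
    by_cases h : bad (k + 1) s p
    · have h' : bad k s p := by
        refine ⟨⟨h.1.1, h.1.2.1, h.1.2.2.trans ?_⟩, h.2⟩
        push_cast
        gcongr
        linarith
      simp [z, h, h']
    · have : z (k + 1) s p = M := by simp [z, h]
      rw [this]
      exact hz' k s p
  have hylim : ∀ s, Tendsto (fun k => y k s) atTop (𝓝 (⨆ k, y k s)) := fun s =>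
    tendsto_atTop_ciSup (hymono s) ⟨M, by
      rintro _ ⟨k, rfl⟩
      exact (ciInf_le (hbdd k s) 0).trans (hz' k s 0)⟩
  -- measurable selection of bad pairs with almost minimal first coordinates
  obtain ⟨e, he⟩ := exists_surjective_nat (ℚ × ℚ)
  have hsel : ∀ k s, ∃ n, s ∈ E → bad k s (e n) ∧ ((e n).1 : ℝ) < y k s + 1 / ((k : ℝ) + 1) := by
    intro k s
    by_cases hs : s ∈ E
    · suffices h : ∃ p, bad k s p ∧ (p.1 : ℝ) < y k s + 1 / ((k : ℝ) + 1) by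
        obtain ⟨p, hp⟩ := h
        obtain ⟨n, rfl⟩ := he p
        exact ⟨n, fun _ => hp⟩
      have hlt : (⨅ p, z k s p) < y k s + 1 / ((k : ℝ) + 1) :=
        lt_add_of_pos_right _ (by positivity)
      obtain ⟨p, hp⟩ := exists_lt_of_ciInf_lt hlt
      by_cases h : bad k s p
      · exact ⟨p, h, by simpa [z, h] using hp⟩
      · obtain ⟨q, hq⟩ := hs k
        have hM : z k s p = M := by simp [z, h]
        exact ⟨q, hq, (abs_le.1 hq.1.1).2.trans_lt (hM ▸ hp)⟩
    · exact ⟨0, fun h => absurd h hs⟩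
  let n : ℕ → B → ℕ := fun k s => Nat.find (hsel k s)
  have hn : ∀ k, Measurable (n k) := by
    intro k
    refine measurable_find (hsel k) fun m => ?_
    have : {s | s ∈ E → bad k s (e m) ∧ ((e m).1 : ℝ) < y k s + 1 / ((k : ℝ) + 1)} =
        Eᶜ ∪ ({s | bad k s (e m)} ∩ {s | ((e m).1 : ℝ) < y k s + 1 / ((k : ℝ) + 1)}) := by
      ext s
      simp [imp_iff_not_or]
    rw [this]
    exact hE.compl.union ((hbad k _).inter
      (measurableSet_lt measurable_const ((hym k).add_const _)))
  have hnspec : ∀ k, ∀ s ∈ E, bad k s (e (n k s)) ∧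
      ((e (n k s)).1 : ℝ) < y k s + 1 / ((k : ℝ) + 1) := fun k s => Nat.find_spec (hsel k s)
  have hlim1 : ∀ s ∈ E, Tendsto (fun k => ((e (n k s)).1 : ℝ)) atTop (𝓝 (⨆ k, y k s)) := by
    intro s hs
    have h1 : Tendsto (fun k => y k s + 1 / ((k : ℝ) + 1)) atTop (𝓝 (⨆ k, y k s)) := by
      simpa using (hylim s).add (tendsto_one_div_add_atTop_nhds_zero_nat (𝕜 := ℝ))
    refine tendsto_of_tendsto_of_tendsto_of_le_of_le (hylim s) h1 (fun k => ?_)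
      (fun k => (hnspec k s hs).2.le)
    have h2 := ciInf_le (hbdd k s) (e (n k s))
    simpa [z, (hnspec k s hs).1] using h2
  have hlim2 : ∀ s ∈ E, Tendsto (fun k => ((e (n k s)).2 : ℝ)) atTop (𝓝 (⨆ k, y k s)) := by
    intro s hs
    have h1 : Tendsto (fun k => ((e (n k s)).1 : ℝ) - (e (n k s)).2) atTop (𝓝 0) :=
      squeeze_zero_norm (fun k => (hnspec k s hs).1.1.2.2)
        (tendsto_one_div_add_atTop_nhds_zero_nat (𝕜 := ℝ))
    simpa using (hlim1 s hs).sub h1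
  exact ⟨hE, fun i => (e i).1, fun i => (e i).2, n, fun s => ⨆ k, y k s, hn, Measurable.iSup hym,
    fun s hs => ⟨hlim1 s hs, hlim2 s hs, fun k => (hnspec k s hs).1.2⟩⟩

/-- The values of a continuous local operator at the rational constants are, at almost every point,
uniformly continuous on bounded sets of rationals. Otherwise two sequences in `L₀` made up of
oscillating pairs would have a common limit, but images staying apart. -/
lemma IsLocalOperator.ae_uniformContinuous {T : LZero ν → LZero ν} (hT : IsLocalOperator T)
    (hc : IsSubseqContinuous T) (M : ℕ) {ε : ℝ} (hε : 0 < ε) :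
    ∀ᵐ s ∂ν, ∃ k : ℕ, ∀ r r' : ℚ, |(r : ℝ)| ≤ M → |(r' : ℝ)| ≤ M →
      |(r : ℝ) - r'| ≤ 1 / ((k : ℝ) + 1) →
      |T (AEEqFun.const B (r : ℝ)) s - T (AEEqFun.const B (r' : ℝ)) s| < ε := by
  obtain ⟨hE, a, b, n, y, hn, hy, hnspec⟩ := exists_oscillation_selection
    (N := fun r => (T (AEEqFun.const B (r : ℝ)) : B → ℝ)) (fun r => (T _).measurable) M ε
  obtain ⟨E, hEdef⟩ : ∃ E : Set B,
    E = oscillationSet (fun r => (T (AEEqFun.const B (r : ℝ)) : B → ℝ)) M ε := ⟨_, rfl⟩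
  rw [← hEdef] at hE hnspec
  suffices h : ∀ᵐ s ∂ν, s ∉ E by
    filter_upwards [h] with s hs
    rw [hEdef, oscillationSet, Set.mem_ofPred_eq] at hs
    push Not at hs
    obtain ⟨k, hk⟩ := hs
    exact ⟨k, fun r r' h1 h2 h3 => hk (r, r') ⟨h1, h2, h3⟩⟩
  -- the corresponding elements of `L₀`, cut off outside `E`
  have hm : ∀ c : ℕ → ℝ, ∀ k, Measurable (E.indicator fun s => c (n k s)) := fun c k =>
    ((Measurable.of_discrete (f := c)).comp (hn k)).indicator hE
  obtain ⟨F, hF⟩ : ∃ F : (ℕ → ℝ) → ℕ → LZero ν,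
      ∀ c, ∀ᵐ s ∂ν, ∀ k, F c k s = E.indicator (fun s => c (n k s)) s :=
    ⟨fun c k => AEEqFun.mk _ (hm c k).aestronglyMeasurable, fun c =>
      ae_all_iff.2 fun k => AEEqFun.coeFn_mk _ _⟩
  have hym' : Measurable (E.indicator y) :=
    hy.indicator hE
  obtain ⟨G, hG⟩ : ∃ G : LZero ν, G =ᵐ[ν] E.indicator y :=
    ⟨AEEqFun.mk _ hym'.aestronglyMeasurable, AEEqFun.coeFn_mk _ _⟩
  have hFlim : ∀ c : ℕ → ℝ,
      (∀ s ∈ E, Tendsto (fun k => c (n k s)) atTop (𝓝 (y s))) →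
      ∀ᵐ s ∂ν, Tendsto (fun k => F c k s) atTop (𝓝 (G s)) := by
    intro c hcE
    filter_upwards [hF c, hG] with s h1 h2
    simp only [h1, h2]
    by_cases hs : s ∈ E
    · simpa [hs] using hcE s hs
    · simp [hs]
  have hTF : ∀ c : ℕ → ℝ, ∀ᵐ s ∂ν, ∀ k, s ∈ E →
      T (F c k) s = T (AEEqFun.const B (c (n k s))) s := by
    intro c
    refine ae_all_iff.2 fun k => hT.ae_eq_of_countable (hn k) c hE ?_
    filter_upwards [hF c] with s h1 hs
    rw [h1, Set.indicator_of_mem hs]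
  -- both sequences converge to `G`; a common subsequence is needed to compare the images
  obtain ⟨ns, hns, h1⟩ := hc (F fun i => (a i : ℝ)) G
    (hFlim (fun i => (a i : ℝ)) fun s hs => (hnspec s hs).1)
  have hsub : ∀ᵐ s ∂ν, Tendsto (fun j => F (fun i => (b i : ℝ)) j s) atTop (𝓝 (G s)) :=
    hFlim _ fun s hs => (hnspec s hs).2.1
  obtain ⟨ms, hms, h2⟩ := hc (fun j => F (fun i => (b i : ℝ)) (ns j)) G
    (hsub.mono fun s hs => hs.comp hns.tendsto_atTop)
  filter_upwards [h1, h2, hTF fun i => (a i : ℝ), hTF fun i => (b i : ℝ)]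
    with s t1 t2 u1 u2 hs
  have h3 := ((t1.comp hms.tendsto_atTop).sub t2).abs
  rw [sub_self, abs_zero] at h3
  refine absurd (ge_of_tendsto' h3 fun j => ?_) (not_le.2 hε)
  have h4 := (hnspec s hs).2.2 (ns (ms j))
  simpa only [Function.comp_apply, u1 _ hs, u2 _ hs] using h4

/-- A function on the rationals which is uniformly continuous on bounded sets extends continuously
to the reals. -/
lemma exists_continuous_extension_of_rat {u : ℚ → ℝ}
    (hu : ∀ M m : ℕ, ∃ k : ℕ, ∀ r r' : ℚ, |(r : ℝ)| ≤ M → |(r' : ℝ)| ≤ M →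
      |(r : ℝ) - r'| ≤ 1 / ((k : ℝ) + 1) → |u r - u r'| < 1 / ((m : ℝ) + 1)) :
    ∃ h : ℝ → ℝ, Continuous h ∧ ∀ q : ℚ, h q = u q := by
  have di : IsDenseInducing ((↑) : ℚ → ℝ) := Rat.isDenseEmbedding_coe_real.isDenseInducing
  have hlim : ∀ b : ℝ, ∃ c, Tendsto u (comap ((↑) : ℚ → ℝ) (𝓝 b)) (𝓝 c) := by
    intro b
    have := di.comap_nhds_neBot b
    refine cauchy_map_iff_exists_tendsto.1 (Metric.cauchy_iff.2 ⟨inferInstance, fun ε hε => ?_⟩)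
    obtain ⟨M, hM⟩ := exists_nat_ge (|b| + 1)
    obtain ⟨m, hm⟩ := exists_nat_one_div_lt hε
    obtain ⟨k, hk⟩ := hu M m
    have hk0 : (0 : ℝ) < 1 / ((k : ℝ) + 1) := by positivity
    have hk1 : 1 / ((k : ℝ) + 1) ≤ 1 := by
      rw [div_le_one (by positivity)]
      linarith [Nat.cast_nonneg (α := ℝ) k]
    refine ⟨u '' (((↑) : ℚ → ℝ) ⁻¹' Metric.ball b (1 / ((k : ℝ) + 1) / 2)),
      image_mem_map (preimage_mem_comap (Metric.ball_mem_nhds b (by positivity))), ?_⟩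
    have hb : ∀ r : ℚ, (r : ℝ) ∈ Metric.ball b (1 / ((k : ℝ) + 1) / 2) → |(r : ℝ)| ≤ M := by
      intro r hr
      rw [Metric.mem_ball, Real.dist_eq] at hr
      have := abs_sub_abs_le_abs_sub (r : ℝ) b
      linarith
    rintro _ ⟨r, hr, rfl⟩ _ ⟨r', hr', rfl⟩
    refine (hk r r' (hb r hr) (hb r' hr') ?_).trans hm
    have h1 := Metric.mem_ball.1 hr
    have h2 := Metric.mem_ball'.1 hr'
    have h3 := dist_triangle (r : ℝ) b r'
    rw [← Real.dist_eq]
    linarith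
  exact ⟨di.extend u, di.continuous_extend hlim, fun q => di.extend_eq' hlim q⟩

lemma tendsto_floor_mul_div (x : ℝ) :
    Tendsto (fun n : ℕ => (⌊x * ((n : ℝ) + 1)⌋ : ℝ) / ((n : ℝ) + 1)) atTop (𝓝 x) := by
  have h1 : Tendsto (fun n : ℕ => x - 1 / ((n : ℝ) + 1)) atTop (𝓝 x) := by
    simpa using (tendsto_one_div_add_atTop_nhds_zero_nat (𝕜 := ℝ)).const_sub x
  refine tendsto_of_tendsto_of_tendsto_of_le_of_le h1 tendsto_const_nhds (fun n => ?_) fun n => ?_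
  · have hn : (0 : ℝ) < (n : ℝ) + 1 := by positivity
    change x - 1 / ((n : ℝ) + 1) ≤ _
    rw [le_div_iff₀ hn, sub_mul, div_mul_cancel₀ _ hn.ne']
    exact (Int.sub_one_lt_floor _).le
  · exact (div_le_iff₀ (by positivity)).2 (Int.floor_le _)

/-- A local operator which is continuous in measure is the superposition operator of a
`𝔎`-function. -/
lemma IsLocalOperator.exists_eq_superposition {T : LZero ν → LZero ν} (hT : IsLocalOperator T)
    (hc : IsSubseqContinuous T) :
    ∃ (N : B → ℝ → ℝ) (hN : IsKFunction ν N), T = superposition N hN.toIsCaratheodory := by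
  classical
  let P : B → Prop := fun s => ∃ h : ℝ → ℝ, Continuous h ∧
    ∀ q : ℚ, h q = T (AEEqFun.const B (q : ℝ)) s
  have hP : ∀ᵐ s ∂ν, P s := by
    have h : ∀ᵐ s ∂ν, ∀ M m : ℕ, ∃ k : ℕ, ∀ r r' : ℚ, |(r : ℝ)| ≤ M → |(r' : ℝ)| ≤ M →
        |(r : ℝ) - r'| ≤ 1 / ((k : ℝ) + 1) →
        |T (AEEqFun.const B (r : ℝ)) s - T (AEEqFun.const B (r' : ℝ)) s| < 1 / ((m : ℝ) + 1) :=
      ae_all_iff.2 fun M => ae_all_iff.2 fun m =>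
        hT.ae_uniformContinuous hc M (by positivity)
    filter_upwards [h] with s hs
    exact exists_continuous_extension_of_rat hs
  -- a measurable null set is discarded, as `N (·, r)` has to be measurable and not only a.e. so
  obtain ⟨Z, hZ, hZm, hZ0⟩ := exists_measurable_superset_of_null (ae_iff.1 hP)
  have hPZ : ∀ s, s ∉ Z → P s := fun s hs => by
    by_contra h
    exact hs (hZ h)
  choose! h hcont hval using hPZ
  let N : B → ℝ → ℝ := fun s x => if s ∈ Z then 0 else h s x
  have hZc : ∀ᵐ s ∂ν, s ∉ Z := measure_eq_zero_iff_ae_notMem.1 hZ0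
  have hNc : ∀ s, Continuous (N s) := by
    intro s
    by_cases hs : s ∈ Z
    · simpa [N, hs] using continuous_const
    · simpa [N, hs] using hcont s hs
  -- rational approximations `⌊x (n + 1)⌋ / (n + 1)` of `x`
  let q : ℤ → ℕ → ℚ := fun i n => (i : ℚ) / ((n : ℚ) + 1)
  have hq : ∀ x : ℝ, Tendsto (fun n : ℕ => (q ⌊x * ((n : ℝ) + 1)⌋ n : ℝ)) atTop (𝓝 x) := by
    intro x
    simpa [q] using tendsto_floor_mul_div x
  have hNq : ∀ r : ℚ, ∀ s, N s r = if s ∈ Z then 0 else T (AEEqFun.const B (r : ℝ)) s := by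
    intro r s
    by_cases hs : s ∈ Z
    · simp [N, hs]
    · simp [N, hs, hval s hs]
  have hN : IsKFunction ν N := by
    refine ⟨⟨fun x => ?_, Eventually.of_forall hNc⟩, ?_⟩
    · refine measurable_of_tendsto_metrizable (f := fun n s => N s (q ⌊x * ((n : ℝ) + 1)⌋ n))
        (fun n => ?_) (tendsto_pi_nhds.2 fun s => ((hNc s).tendsto x).comp (hq x))
      simp only [hNq]
      exact Measurable.ite hZm measurable_const (AEEqFun.measurable _)
    · have h0 : (AEEqFun.const B ((0 : ℚ) : ℝ) : LZero ν) = 0 := by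
        rw [Rat.cast_zero]; rfl
      filter_upwards [hZc, AEEqFun.coeFn_zero (μ := ν) (β := ℝ)] with s hs hs0
      have h1 := hNq 0 s
      rw [h0, hT.map_zero, hs0] at h1
      simpa [hs] using h1
  refine ⟨N, hN, funext fun g => AEEqFun.ext ?_⟩
  have mn : ∀ n : ℕ, Measurable fun s => ⌊g s * ((n : ℝ) + 1)⌋ := fun n =>
    (g.measurable.mul_const _).floor
  have mg : ∀ n : ℕ, Measurable fun s => ((q ⌊g s * ((n : ℝ) + 1)⌋ n : ℚ) : ℝ) := fun n =>
    (Measurable.of_discrete (f := fun i : ℤ => (q i n : ℝ))).comp (mn n)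
  let G : ℕ → LZero ν := fun n => AEEqFun.mk _ (mg n).aestronglyMeasurable
  have hG : ∀ᵐ s ∂ν, ∀ n, G n s = q ⌊g s * ((n : ℝ) + 1)⌋ n :=
    ae_all_iff.2 fun n => AEEqFun.coeFn_mk _ _
  have hTG : ∀ᵐ s ∂ν, ∀ n, s ∈ Set.univ →
      T (G n) s = T (AEEqFun.const B (q ⌊g s * ((n : ℝ) + 1)⌋ n : ℝ)) s :=
    ae_all_iff.2 fun n => hT.ae_eq_of_countable (mn n) (fun i => (q i n : ℝ)) MeasurableSet.univ
      (hG.mono fun s hs _ => hs n)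
  obtain ⟨ns, hns, hlim⟩ := hc G g (hG.mono fun s hs => by simpa only [hs] using hq (g s))
  filter_upwards [hTG, hlim, hZc, AEEqFun.coeFn_mk _ (hN.aestronglyMeasurable_comp g)]
    with s h1 h2 h3 h4
  rw [superposition, h4]
  refine tendsto_nhds_unique h2 ?_
  have h5 : ∀ j, T (G (ns j)) s = N s (q ⌊g s * ((ns j : ℝ) + 1)⌋ (ns j)) := by
    intro j
    rw [h1 _ (Set.mem_univ s), hNq, if_neg h3]
  simp only [h5]
  exact ((hNc s).tendsto (g s)).comp ((hq (g s)).comp hns.tendsto_atTop)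

end LocalOperators

/-! ### Operators subordinate to an isomorphism -/

section Subordinate

variable {A B : Type*} [MeasurableSpace A] [MeasurableSpace B] {μ : Measure A} {ν : Measure B}

/-- Being atomic subordinate, in terms of measurable sets in place of order projections. -/
lemma isAtomicSubordinate_iff {Φ : MeasAlg μ → MeasAlg ν} {T : LZero μ → LZero ν} :
    IsAtomicSubordinate (orderProjectionMap Φ) T ↔
      ∀ D f, T (mulChi D f) = mulChi (Φ D) (T f) := by
  constructor
  · intro h D f
    have h1 := h (measAlgEquivOrderProjection μ D) f
    rwa [orderProjectionMap, Equiv.symm_apply_apply] at h1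
  · intro h π f
    obtain ⟨D, rfl⟩ := (measAlgEquivOrderProjection μ).surjective π
    rw [orderProjectionMap, Equiv.symm_apply_apply]
    exact h D f

lemma coeFn_superposition {N : B → ℝ → ℝ} (hN : IsCaratheodory ν N) (f : LZero ν) :
    superposition N hN f =ᵐ[ν] fun s => N s (f s) :=
  AEEqFun.coeFn_mk _ _

lemma superposition_mulChi {N : B → ℝ → ℝ} (hN : IsKFunction ν N) (D : MeasAlg ν) (f : LZero ν) :
    superposition N hN.toIsCaratheodory (mulChi D f) =
      mulChi D (superposition N hN.toIsCaratheodory f) := by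
  obtain ⟨s, hs, rfl⟩ := D.exists_mk
  refine AEEqFun.ext ?_
  filter_upwards [coeFn_mulChi_mk s hs f, hN.zero,
    coeFn_mulChi_mk s hs (superposition N hN.toIsCaratheodory f),
    coeFn_superposition hN.toIsCaratheodory f,
    coeFn_superposition hN.toIsCaratheodory (mulChi (MeasAlg.mk ν s hs) f)] with b h1 h2 h3 h4 h5
  rw [h5, h1, h3]
  by_cases hb : b ∈ s
  · simp [hb, h4]
  · simp [hb, h2]

lemma IsCaratheodory.isSubseqContinuous {N : B → ℝ → ℝ} (hN : IsCaratheodory ν N)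
    (Φ : MeasAlg μ ≃o MeasAlg ν) :
    IsSubseqContinuous (superposition N hN ∘ shiftOperator Φ : LZero μ → LZero ν) := by
  intro g f hg
  refine ⟨id, strictMono_id, ?_⟩
  filter_upwards [ae_tendsto_shiftOperator (Φ := Φ) hg, hN.continuous,
    coeFn_superposition hN (shiftOperator Φ f),
    ae_all_iff.2 fun n => coeFn_superposition hN (shiftOperator Φ (g n))] with b h1 h2 h3 h4
  simp only [Function.comp_apply, id, h3, h4]
  exact (h2.tendsto _).comp h1

end Subordinate

end AtomicOperators

theorem theorem3p2 {A B : Type*} [MeasurableSpace A] [MeasurableSpace B]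
    (μ : Measure A) (ν : Measure B) [SigmaFinite μ] [SigmaFinite ν]
    (lamA : Measure A) (lamB : Measure B) [IsFiniteMeasure lamA] [IsFiniteMeasure lamB]
    (hA : lamA ≪ μ) (hA' : μ ≪ lamA) (hB : lamB ≪ ν) (hB' : ν ≪ lamB)
    (Φ : MeasAlg μ → MeasAlg ν) (hΦ : IsBooleanHom Φ) (hΦ' : Function.Bijective Φ)
    (T : LZero μ → LZero ν) (hT : IsRegularOA T) :
    (IsRhoContinuous lamA lamB T ∧ IsAtomicSubordinate (orderProjectionMap Φ) T) ↔
      ∃ (N : B → ℝ → ℝ) (hN : IsKFunction ν N),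
        T = superposition N hN.toIsCaratheodory ∘ shiftOperator Φ := by
  rw [isRhoContinuous_iff hA hA' hB hB', isAtomicSubordinate_iff]
  obtain ⟨e, rfl⟩ : ∃ e : MeasAlg μ ≃o MeasAlg ν, ⇑e = Φ := ⟨hΦ.toOrderIso hΦ', rfl⟩
  constructor
  · rintro ⟨hc, ha⟩
    have hloc : IsLocalOperator (T ∘ shiftOperator e.symm) := by
      intro D g
      rw [Function.comp_apply, shiftOperator_mulChi, ha, OrderIso.apply_symm_apply,
        Function.comp_apply]
    have hcont : IsSubseqContinuous (T ∘ shiftOperator e.symm) := fun g f h =>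
      hc (fun n => shiftOperator e.symm (g n)) (shiftOperator e.symm f)
        (ae_tendsto_shiftOperator h)
    obtain ⟨N, hN, h⟩ := hloc.exists_eq_superposition hcont
    refine ⟨N, hN, funext fun f => ?_⟩
    rw [← h]
    simp only [Function.comp_apply, shiftOperator_symm_shiftOperator]
  · rintro ⟨N, hN, rfl⟩
    refine ⟨hN.toIsCaratheodory.isSubseqContinuous e, fun D f => ?_⟩
    rw [Function.comp_apply, shiftOperator_mulChi, superposition_mulChi hN, Function.comp_apply]
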